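/- **Theorem 3 (Capillary-gravity waves).** Let $\rho_1,\rho_2,\sigma,h_1,h_2>0$ and $g\in\mathbb R$ be constants. Let $\eta\in C^2(\mathbb R^2)$ satisfy $-h_1<\inf\eta$ and $\sup\eta<h_2$, and put $$\Omega_1=\{(x,y,z):-h_1<z<\eta(x,y)\},\qquad \Omega_2=\{(x,y,z):\eta(x,y)<z<h_2\}.$$ For $i=1,2$ let $\boldsymbol u_i=(u_i,v_i,w_i)\in C^1(\overline{\Omega_i};\mathbb R^3)$ and $P_i\in C^1(\overline{\Omega_i})$ solve the internal capillary-gravity wave problem $$\rho_i(\boldsymbol u_i\cdot\nabla)\boldsymbol u_i=-\nabla P_i+\rho_i(0,0,-g),\qquad \nabla\cdot\boldsymbol u_i=0\qquad\text{in }\Omega_i,$$ $$u_i\eta_x+v_i\eta_y=w_i\quad\text{on }z=\eta(x,y),\qquad w_1=0\ \text{ on }z=-h_1,\qquad w_2=0\ \text{ on }z=h_2,$$ $$P_2-P_1=\sigma\,\frac{(1+\eta_y^2)\eta_{xx}-2\eta_x\eta_y\eta_{xy}+(1+\eta_x^2)\eta_{yy}}{(1+\eta_x^2+\eta_y^2)^{3/2}}\quad\text{on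 }z=\eta(x,y).$$ Assume that 1. the vorticities $\boldsymbol\omega_i=\nabla\times\boldsymbol u_i$ are constant in $\Omega_i$, nonzero, and parallel to each other; 2. $\|\boldsymbol u_1\|_{C^1(\Omega_1)}$, $\|\boldsymbol u_2\|_{C^1(\Omega_2)}$ and $\|\eta\|_{C^2(\mathbb R^2)}$ are finite; 3. $\sup\,(\partial_zP_1-\partial_zP_2)|_{z=\eta}<0$. Then the wave is two dimensional. That is, there is a horizontal unit vector $\boldsymbol e=(a,b,0)$, parallel to both $\boldsymbol\omega_1$ and $\boldsymbol\omega_2$, such that $\eta$ is constant along all lines in $\mathbb R^2$ of direction $(a,b)$, and for $i=1,2$ the velocity $\boldsymbol u_i$ and the pressure $P_i$ do not vary in the direction $\boldsymbol e$ in $\overline{\Omega_i}$, and $\boldsymbol u_i\cdot\boldsymbol e$ is constant in $\overline{\Omega_i}$. (In horizontal axes with $\boldsymbol e$ as the $y$-axis: $\boldsymbol u_i=(u_i(x,z),V_i,w_i(x,z))$ with constants $V_i$, $P_i=P_i(x,z)$ and $\eta=\eta(x)$.) -/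

import Mathlib

/-- The partial derivative `∂f/∂x_j` at `p` of a scalar function of `n` real variables. -/
noncomputable def pd {n : ℕ} (j : Fin n) (f : (Fin n → ℝ) → ℝ) (p : Fin n → ℝ) : ℝ :=
  fderiv ℝ f p (Pi.single j 1)

/-- The partial derivative at `p` of a function that is differentiable on `S` up to its boundary. -/
noncomputable def pdWithin {n : ℕ} (S : Set (Fin n → ℝ)) (j : Fin n) (f : (Fin n → ℝ) → ℝ)
    (p : Fin n → ℝ) : ℝ :=
  fderivWithin ℝ f S p (Pi.single j 1)

/-- `f` has finite `C^k` norm on the open set `S`: its derivatives of order at most `k`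
are bounded there. -/
def FiniteCkNorm {n : ℕ} {F : Type*} [NormedAddCommGroup F] [NormedSpace ℝ F]
    (k : ℕ) (S : Set (Fin n → ℝ)) (f : (Fin n → ℝ) → F) : Prop :=
  ∃ M : ℝ, ∀ m ≤ k, ∀ p ∈ S, ‖iteratedFDeriv ℝ m f p‖ ≤ M

/-- The curl of a vector field on `ℝ³`. -/
noncomputable def curl (u : (Fin 3 → ℝ) → (Fin 3 → ℝ)) (p : Fin 3 → ℝ) : Fin 3 → ℝ :=
  ![pd 1 (fun q => u q 2) p - pd 2 (fun q => u q 1) p,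
    pd 2 (fun q => u q 0) p - pd 0 (fun q => u q 2) p,
    pd 0 (fun q => u q 1) p - pd 1 (fun q => u q 0) p]

/-- The lower layer `-h₁ < z < η(x, y)`. -/
def lowerLayer (h₁ : ℝ) (η : (Fin 2 → ℝ) → ℝ) : Set (Fin 3 → ℝ) :=
  {p | -h₁ < p 2 ∧ p 2 < η ![p 0, p 1]}

/-- The upper layer `η(x, y) < z < h₂`. -/
def upperLayer (h₂ : ℝ) (η : (Fin 2 → ℝ) → ℝ) : Set (Fin 3 → ℝ) :=
  {p | η ![p 0, p 1] < p 2 ∧ p 2 < h₂}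

/-- The point of the interface `z = η(x, y)` above `(x, y)`. -/
def interfacePoint (η : (Fin 2 → ℝ) → ℝ) (x : Fin 2 → ℝ) : Fin 3 → ℝ :=
  ![x 0, x 1, η x]

/-- A classical solution of the steady incompressible Euler equations in `Ω` with density `ρ` and
gravity `(0, 0, -g)`: velocity `u` and pressure `P` are `C¹` up to the boundary. -/
structure IsSteadyEuler (ρ g : ℝ) (Ω : Set (Fin 3 → ℝ)) (u : (Fin 3 → ℝ) → (Fin 3 → ℝ))
    (P : (Fin 3 → ℝ) → ℝ) : Prop where
  contDiffOn_velocity : ContDiffOn ℝ 1 u (closure Ω)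
  contDiffOn_pressure : ContDiffOn ℝ 1 P (closure Ω)
  momentum : ∀ p ∈ Ω, ∀ k : Fin 3,
    ρ * ∑ j : Fin 3, u p j * pd j (fun q => u q k) p = -pd k P p + ρ * (![0, 0, -g] : Fin 3 → ℝ) k
  incompressible : ∀ p ∈ Ω, ∑ j : Fin 3, pd j (fun q => u q j) p = 0

/-- The mean curvature expression
`((1 + η_y²) η_xx - 2 η_x η_y η_xy + (1 + η_x²) η_yy) / (1 + η_x² + η_y²)^(3/2)`. -/
noncomputable def meanCurvature (η : (Fin 2 → ℝ) → ℝ) (x : Fin 2 → ℝ) : ℝ :=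
  ((1 + pd 1 η x ^ 2) * pd 0 (pd 0 η) x - 2 * pd 0 η x * pd 1 η x * pd 1 (pd 0 η) x
      + (1 + pd 0 η x ^ 2) * pd 1 (pd 1 η) x)
    / (1 + pd 0 η x ^ 2 + pd 1 η x ^ 2) ^ (3 / 2 : ℝ)

/-- A classical solution of the internal capillary-gravity wave problem in the channel
`-h₁ < z < h₂`; index `1` is the lower fluid, index `2` the upper fluid. -/
structure IsCapillaryGravityWave (ρ₁ ρ₂ g σ h₁ h₂ : ℝ) (η : (Fin 2 → ℝ) → ℝ)
    (u₁ u₂ : (Fin 3 → ℝ) → (Fin 3 → ℝ)) (P₁ P₂ : (Fin 3 → ℝ) → ℝ) : Prop where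
  contDiff_interface : ContDiff ℝ 2 η
  /-- `-h₁ < inf η` -/
  above_bed : ∃ δ : ℝ, 0 < δ ∧ ∀ x, -h₁ + δ ≤ η x
  /-- `sup η < h₂` -/
  below_lid : ∃ δ : ℝ, 0 < δ ∧ ∀ x, η x ≤ h₂ - δ
  euler_lower : IsSteadyEuler ρ₁ g (lowerLayer h₁ η) u₁ P₁
  euler_upper : IsSteadyEuler ρ₂ g (upperLayer h₂ η) u₂ P₂
  kinematic_lower : ∀ x, u₁ (interfacePoint η x) 0 * pd 0 η x + u₁ (interfacePoint η x) 1 * pd 1 η x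
    = u₁ (interfacePoint η x) 2
  kinematic_upper : ∀ x, u₂ (interfacePoint η x) 0 * pd 0 η x + u₂ (interfacePoint η x) 1 * pd 1 η x
    = u₂ (interfacePoint η x) 2
  kinematic_bed : ∀ p, p 2 = -h₁ → u₁ p 2 = 0
  kinematic_lid : ∀ p, p 2 = h₂ → u₂ p 2 = 0
  young_laplace : ∀ x,
    P₂ (interfacePoint η x) - P₁ (interfacePoint η x) = σ * meanCurvature η x

/-- The flow `(u, P)` in the closed region `D` is two dimensional with respect to the direction `e`:
it does not vary along `e`, and the velocity component along `e` is constant. -/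
def IsTwoDimensionalFlow (e : Fin 3 → ℝ) (D : Set (Fin 3 → ℝ))
    (u : (Fin 3 → ℝ) → (Fin 3 → ℝ)) (P : (Fin 3 → ℝ) → ℝ) : Prop :=
  (∀ p ∈ D, ∀ t : ℝ, p + t • e ∈ D → u (p + t • e) = u p ∧ P (p + t • e) = P p) ∧
    ∃ V : ℝ, ∀ p ∈ D, u p ⬝ᵥ e = V

open Filter Topology

/-! Write `e = (a, b, 0)`, `n = (b, -a, 0)`, `w` for the vertical velocity and `q` for the velocity
along `n`.

A bounded field on a horizontal plane has zero mean vertical vorticity, because circulation around a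
square of side `R` is `O(R)` while the flux of vorticity is `k R²`. So the common vorticity
direction is a horizontal `e`.

With vorticity `γ e`, the Bernoulli function has gradient `u × γ e`, which involves only `w` and
`q`. Symmetry of its second derivative gives `∂ₑw = ∂ₑq = 0` (`fderiv_axis`). The curl and
divergence equations then show that the axial velocity varies at most along `e`, and linearly so on
full lines. Each layer contains a slab with such lines, where boundedness makes the axial velocity
constant (`exists_axial_eq`). The interface may cut lines of direction `e`, so vanishing derivatives
do not yet give invariance in the whole layer. But `(q - γ z) - i w` is holomorphic in planes
orthogonal to `e`, so agreement of parallel planes in the slab continues to the rest of the layer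
(`velocity_components_invariant`). The Bernoulli function carries this over to the pressure.

For the interface, compare `η` with a translate `ζ` along `e`. Where `ζ > η`, invariance of the
pressures and the sign condition make the pressure jump grow by at least `δ (ζ - η)`
(`pressure_jump_growth`). By Young-Laplace the mean curvature of `ζ` exceeds that of `η` by a
multiple of `ζ - η`, contrary to the maximum principle (`le_of_meanCurvature_comparison`). Hence `ζ
≤ η` for every translate, including the opposite ones. -/

theorem fderiv_apply_eq_sum_pd {n : ℕ} (f : (Fin n → ℝ) → ℝ) (p v : Fin n → ℝ) :
    fderiv ℝ f p v = ∑ j, v j * pd j f p := by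
  conv_lhs => rw [← Finset.univ_sum_single v, map_sum]
  refine Finset.sum_congr rfl fun j _ => ?_
  have : (Pi.single j (v j) : Fin n → ℝ) = v j • Pi.single j 1 := by
    rw [← Pi.single_smul, smul_eq_mul, mul_one]
  rw [this, map_smul, smul_eq_mul, pd]

/-! ### Layers and interior regularity -/

/-- The region between the graphs of `lo` and `hi`. -/
def layer (lo hi : (Fin 2 → ℝ) → ℝ) : Set (Fin 3 → ℝ) :=
  {p | lo ![p 0, p 1] < p 2 ∧ p 2 < hi ![p 0, p 1]}

theorem continuous_horizontal : Continuous fun p : Fin 3 → ℝ => ![p 0, p 1] := by fun_prop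

theorem isOpen_layer {lo hi : (Fin 2 → ℝ) → ℝ} (hlo : Continuous lo) (hhi : Continuous hi) :
    IsOpen (layer lo hi) :=
  (isOpen_lt (hlo.comp continuous_horizontal) (continuous_apply 2)).inter
    (isOpen_lt (continuous_apply 2) (hhi.comp continuous_horizontal))

theorem closure_layer_subset {lo hi : (Fin 2 → ℝ) → ℝ} (hlo : Continuous lo) (hhi : Continuous hi) :
    closure (layer lo hi) ⊆ {p | lo ![p 0, p 1] ≤ p 2 ∧ p 2 ≤ hi ![p 0, p 1]} :=
  closure_minimal (fun _ hp => ⟨hp.1.le, hp.2.le⟩)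
    ((isClosed_le (hlo.comp continuous_horizontal) (continuous_apply 2)).inter
      (isClosed_le (continuous_apply 2) (hhi.comp continuous_horizontal)))

theorem IsSteadyEuler.differentiableAt_velocity {ρ g : ℝ} {Ω : Set (Fin 3 → ℝ)}
    {u : (Fin 3 → ℝ) → (Fin 3 → ℝ)} {P : (Fin 3 → ℝ) → ℝ} (h : IsSteadyEuler ρ g Ω u P)
    (hΩ : IsOpen Ω) {p : Fin 3 → ℝ} (hp : p ∈ Ω) : DifferentiableAt ℝ u p :=
  (h.contDiffOn_velocity.contDiffAt
    (Filter.mem_of_superset (hΩ.mem_nhds hp) subset_closure)).differentiableAt one_ne_zero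

theorem IsSteadyEuler.differentiableAt_pressure {ρ g : ℝ} {Ω : Set (Fin 3 → ℝ)}
    {u : (Fin 3 → ℝ) → (Fin 3 → ℝ)} {P : (Fin 3 → ℝ) → ℝ} (h : IsSteadyEuler ρ g Ω u P)
    (hΩ : IsOpen Ω) {p : Fin 3 → ℝ} (hp : p ∈ Ω) : DifferentiableAt ℝ P p :=
  (h.contDiffOn_pressure.contDiffAt
    (Filter.mem_of_superset (hΩ.mem_nhds hp) subset_closure)).differentiableAt one_ne_zero

theorem hasFDerivAt_component {u : (Fin 3 → ℝ) → (Fin 3 → ℝ)} {p : Fin 3 → ℝ}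
    (h : DifferentiableAt ℝ u p) (k : Fin 3) :
    HasFDerivAt (fun q => u q k) (fderiv ℝ (fun q => u q k) p) p :=
  (differentiableAt_pi.1 h k).hasFDerivAt

/-! ### Bernoulli function and vertical vorticity -/

/-- The Bernoulli function (total head) of a flow. -/
noncomputable def bernoulliHead (ρ g : ℝ) (u : (Fin 3 → ℝ) → (Fin 3 → ℝ)) (P : (Fin 3 → ℝ) → ℝ)
    (p : Fin 3 → ℝ) : ℝ :=
  ρ⁻¹ * P p + g * p 2 + 2⁻¹ * (u p 0 ^ 2 + u p 1 ^ 2 + u p 2 ^ 2)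

/-- The gradient of the Bernoulli function is the Lamb vector `u × ω`. -/
theorem IsSteadyEuler.hasFDerivAt_bernoulliHead {ρ g : ℝ} {Ω : Set (Fin 3 → ℝ)}
    {u : (Fin 3 → ℝ) → (Fin 3 → ℝ)} {P : (Fin 3 → ℝ) → ℝ} {ω : Fin 3 → ℝ}
    (h : IsSteadyEuler ρ g Ω u P) (hρ : ρ ≠ 0) (hΩ : IsOpen Ω) {p : Fin 3 → ℝ} (hp : p ∈ Ω)
    (hω : curl u p = ω) :
    HasFDerivAt (bernoulliHead ρ g u P)
      (∑ j, (crossProduct (u p) ω) j • (ContinuousLinearMap.proj j : (Fin 3 → ℝ) →L[ℝ] ℝ)) p := by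
  have hu := h.differentiableAt_velocity hΩ hp
  have hP := (h.differentiableAt_pressure hΩ hp).hasFDerivAt
  have hz : HasFDerivAt (fun q : Fin 3 → ℝ => q 2)
    (ContinuousLinearMap.proj 2 : (Fin 3 → ℝ) →L[ℝ] ℝ) p := hasFDerivAt_apply 2 p
  have h0 := hasFDerivAt_component hu 0
  have h1 := hasFDerivAt_component hu 1
  have h2 := hasFDerivAt_component hu 2
  refine (((hP.const_mul ρ⁻¹).add (hz.const_mul g)).add
    (((((h0.pow 2).add (h1.pow 2)).add (h2.pow 2))).const_mul (2⁻¹ : ℝ))).congr_fderiv ?_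
  have m0 := h.momentum p hp 0
  have m1 := h.momentum p hp 1
  have m2 := h.momentum p hp 2
  subst hω
  ext v
  simp only [Fin.sum_univ_three, add_apply, smul_apply,
    fderiv_apply_eq_sum_pd, ContinuousLinearMap.proj_apply, smul_eq_mul, curl, cross_apply,
    Matrix.cons_val, Matrix.cons_val_zero, Matrix.cons_val_one] at m0 m1 m2 ⊢
  have i0 := eq_sub_of_add_eq m0.symm
  have i1 := eq_sub_of_add_eq m1.symm
  have i2 := eq_sub_of_add_eq m2.symm
  rw [neg_eq_iff_eq_neg] at i0 i1 i2
  rw [i0, i1, i2]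
  field_simp
  simp only [nsmul_eq_mul]
  push_cast
  ring

/-- A bounded field on a horizontal plane cannot have a nonzero constant vertical vorticity. -/
theorem vertical_vorticity_eq_zero {u : (Fin 3 → ℝ) → (Fin 3 → ℝ)} {c k M : ℝ}
    (hu : ∀ x y : ℝ, DifferentiableAt ℝ u ![x, y, c])
    (hk : ∀ x y : ℝ, pd 0 (fun q => u q 1) ![x, y, c] - pd 1 (fun q => u q 0) ![x, y, c] = k)
    (hM : ∀ x y : ℝ, ‖u ![x, y, c]‖ ≤ M) : k = 0 := by
  let J : ℝ × ℝ →L[ℝ] (Fin 3 → ℝ) :=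
    ContinuousLinearMap.pi ![ContinuousLinearMap.fst ℝ ℝ ℝ, ContinuousLinearMap.snd ℝ ℝ ℝ, 0]
  have hJ : ∀ x : ℝ × ℝ, HasFDerivAt (fun x : ℝ × ℝ => ![x.1, x.2, c]) J x := by
    intro x
    rw [hasFDerivAt_pi']
    intro i
    fin_cases i
    · exact hasFDerivAt_fst
    · exact hasFDerivAt_snd
    · exact hasFDerivAt_const c x
  have hJ0 : J (1, 0) = Pi.single 0 1 := by
    ext i; fin_cases i <;> simp [J]
  have hJ1 : J (0, 1) = Pi.single 1 1 := by
    ext i; fin_cases i <;> simp [J]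
  have hcomp : ∀ (j : Fin 3) (x : ℝ × ℝ), HasFDerivAt (fun x : ℝ × ℝ => u ![x.1, x.2, c] j)
      ((fderiv ℝ (fun q => u q j) ![x.1, x.2, c]).comp J) x := fun j x =>
    HasFDerivAt.comp (g := fun q => u q j) x (hasFDerivAt_component (hu x.1 x.2) j) (hJ x)
  have hcont : ∀ j, Continuous fun x : ℝ × ℝ => u ![x.1, x.2, c] j := fun j =>
    continuous_iff_continuousAt.2 fun x => (hcomp j x).continuousAt
  have hdiv : ∀ x : ℝ × ℝ, (fderiv ℝ (fun q => u q 1) ![x.1, x.2, c]).comp J (1, 0)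
      + (-((fderiv ℝ (fun q => u q 0) ![x.1, x.2, c]).comp J)) (0, 1) = k := by
    intro x
    rw [neg_apply, ContinuousLinearMap.comp_apply,
      ContinuousLinearMap.comp_apply, hJ0, hJ1, ← sub_eq_add_neg]
    exact hk x.1 x.2
  have hbound : ∀ (j : Fin 3) (x y : ℝ), ‖u ![x, y, c] j‖ ≤ M := fun j x y =>
    (norm_le_pi_norm _ j).trans (hM x y)
  -- Green's theorem on the square `[0, R]²`: the flux `k R²` equals a circulation of size at most
  -- `4 M R`.
  have key : ∀ R : ℝ, 0 < R → |k| * R ≤ 4 * M := by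
    intro R hR
    have h := MeasureTheory.integral2_divergence_prod_of_hasFDerivAt
      (fun x : ℝ × ℝ => u ![x.1, x.2, c] 1) (fun x : ℝ × ℝ => -u ![x.1, x.2, c] 0)
      (fun x => (fderiv ℝ (fun q => u q 1) ![x.1, x.2, c]).comp J)
      (fun x => -((fderiv ℝ (fun q => u q 0) ![x.1, x.2, c]).comp J)) 0 0 R R
      (hcont 1).continuousOn (hcont 0).neg.continuousOn (fun x _ => hcomp 1 x)
      (fun x _ => (hcomp 0 x).neg) (by
        simp only [hdiv]
        exact (continuous_const.continuousOn).integrableOn_compact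
          (isCompact_uIcc.prod isCompact_uIcc))
    have hdiv' := fun x y => hdiv (x, y)
    simp only at hdiv'
    simp only [hdiv', intervalIntegral.integral_const, smul_eq_mul, sub_zero] at h
    have e1 := intervalIntegral.norm_integral_le_of_norm_le_const (a := 0) (b := R)
      (f := fun x => -u ![x, R, c] 0) (C := M) fun x _ => by simpa using hbound 0 x R
    have e2 := intervalIntegral.norm_integral_le_of_norm_le_const (a := 0) (b := R)
      (f := fun x => -u ![x, 0, c] 0) (C := M) fun x _ => by simpa using hbound 0 x 0
    have e3 := intervalIntegral.norm_integral_le_of_norm_le_const (a := 0) (b := R)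
      (f := fun y => u ![R, y, c] 1) (C := M) fun y _ => hbound 1 R y
    have e4 := intervalIntegral.norm_integral_le_of_norm_le_const (a := 0) (b := R)
      (f := fun y => u ![0, y, c] 1) (C := M) fun y _ => hbound 1 0 y
    rw [sub_zero, abs_of_pos hR, Real.norm_eq_abs, abs_le] at e1 e2 e3 e4
    have h' : |R * (R * k)| ≤ 4 * (M * R) := by
      rw [h, abs_le]
      constructor <;> linarith [e1.1, e1.2, e2.1, e2.2, e3.1, e3.2, e4.1, e4.2]
    rw [abs_mul, abs_mul, abs_of_pos hR] at h'
    exact le_of_mul_le_mul_left (by linarith) hR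
  by_contra hne
  have hpos := abs_pos.2 hne
  have hM0 : 0 ≤ M := (norm_nonneg _).trans (hM 0 0)
  have := key ((4 * M + 1) / |k|) (by positivity)
  rw [mul_div_cancel₀ _ hpos.ne'] at this
  linarith

/-! ### Constant horizontal vorticity: constancy of the axial velocity -/

/-- A bounded steady flow in the layer `lo < z < hi`, which contains the slab `c₁ < z < c₂`,
with constant nonzero vorticity `γ (a, b, 0)`, where `(a, b)` is a unit vector. -/
structure IsHorizontalVorticityFlow (ρ g γ a b c₁ c₂ M : ℝ) (lo hi : (Fin 2 → ℝ) → ℝ)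
    (u : (Fin 3 → ℝ) → (Fin 3 → ℝ)) (P : (Fin 3 → ℝ) → ℝ) : Prop where
  density_ne_zero : ρ ≠ 0
  vorticity_ne_zero : γ ≠ 0
  unit : a ^ 2 + b ^ 2 = 1
  continuous_lo : Continuous lo
  continuous_hi : Continuous hi
  slab : c₁ < c₂
  lo_le : ∀ x, lo x ≤ c₁
  le_hi : ∀ x, c₂ ≤ hi x
  euler : IsSteadyEuler ρ g (layer lo hi) u P
  curl_eq : ∀ p ∈ layer lo hi, curl u p = γ • ![a, b, 0]
  bound : ∀ p ∈ layer lo hi, ‖u p‖ ≤ M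

/-- The horizontal velocity component along `(a, b)`. -/
def axial (a b : ℝ) (u : (Fin 3 → ℝ) → (Fin 3 → ℝ)) (p : Fin 3 → ℝ) : ℝ := a * u p 0 + b * u p 1

/-- The horizontal velocity component along `(b, -a)`. -/
def transverse (a b : ℝ) (u : (Fin 3 → ℝ) → (Fin 3 → ℝ)) (p : Fin 3 → ℝ) : ℝ :=
  b * u p 0 - a * u p 1

theorem hasFDerivAt_axial (a b : ℝ) {u : (Fin 3 → ℝ) → (Fin 3 → ℝ)} {p : Fin 3 → ℝ}
    (h : DifferentiableAt ℝ u p) :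
    HasFDerivAt (axial a b u)
      (a • fderiv ℝ (fun q => u q 0) p + b • fderiv ℝ (fun q => u q 1) p) p :=
  ((hasFDerivAt_component h 0).const_mul a).add ((hasFDerivAt_component h 1).const_mul b)

theorem hasFDerivAt_transverse (a b : ℝ) {u : (Fin 3 → ℝ) → (Fin 3 → ℝ)} {p : Fin 3 → ℝ}
    (h : DifferentiableAt ℝ u p) :
    HasFDerivAt (transverse a b u)
      (b • fderiv ℝ (fun q => u q 0) p - a • fderiv ℝ (fun q => u q 1) p) p :=
  ((hasFDerivAt_component h 0).const_mul b).sub ((hasFDerivAt_component h 1).const_mul a)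

theorem velocity_eq {a b : ℝ} (hab : a ^ 2 + b ^ 2 = 1) (v : (Fin 3 → ℝ) → (Fin 3 → ℝ)) (p : Fin 3 → ℝ) :
    v p = ![a * axial a b v p + b * transverse a b v p,
      b * axial a b v p - a * transverse a b v p, v p 2] := by
  ext i
  fin_cases i
  · simp [axial, transverse]; linear_combination -v p 0 * hab
  · simp [axial, transverse]; linear_combination -v p 1 * hab
  · rfl

theorem eq_of_fderiv_segment_eq_zero {E : Type*} [NormedAddCommGroup E] [NormedSpace ℝ E]
    {f : E → ℝ} {p q : E}
    (hd : ∀ r ∈ segment ℝ p q, DifferentiableAt ℝ f r)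
    (h0 : ∀ r ∈ segment ℝ p q, fderiv ℝ f r (q - p) = 0) : f q = f p := by
  obtain ⟨z, hz, h⟩ := domain_mvt (fun r hr => (hd r hr).hasFDerivAt.hasFDerivWithinAt)
    (convex_segment p q) (left_mem_segment ℝ p q) (right_mem_segment ℝ p q)
  rw [h0 z hz] at h
  linarith

theorem segment_subset_layer_of_vertical {lo hi : (Fin 2 → ℝ) → ℝ} {p q : Fin 3 → ℝ}
    (hp : p ∈ layer lo hi) (hq : q ∈ layer lo hi) (h0 : q 0 = p 0) (h1 : q 1 = p 1) :
    segment ℝ p q ⊆ layer lo hi := by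
  rintro r ⟨s, t, hs, ht, hst, rfl⟩
  have e0 : (s • p + t • q) 0 = p 0 := by
    simp only [Pi.add_apply, Pi.smul_apply, smul_eq_mul, h0, ← add_mul, hst, one_mul]
  have e1 : (s • p + t • q) 1 = p 1 := by
    simp only [Pi.add_apply, Pi.smul_apply, smul_eq_mul, h1, ← add_mul, hst, one_mul]
  have hq' := hq
  simp only [layer, Set.mem_ofPred_eq, h0, h1] at hq'
  have := (convex_Ioo (lo ![p 0, p 1]) (hi ![p 0, p 1])) hp hq' hs ht hst
  simp only [layer, Set.mem_ofPred_eq, e0, e1]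
  exact this

theorem eq_vertical_single {p q : Fin 3 → ℝ} (h0 : q 0 = p 0) (h1 : q 1 = p 1) :
    q - p = (q 2 - p 2) • (Pi.single 2 1 : Fin 3 → ℝ) := by
  ext i; fin_cases i <;> simp [h0, h1]

/-- A function without vertical derivative in a layer takes equal values on a vertical line. -/
theorem eq_of_vertical {lo hi : (Fin 2 → ℝ) → ℝ} {f : (Fin 3 → ℝ) → ℝ}
    (hd : ∀ r ∈ layer lo hi, DifferentiableAt ℝ f r) {p q : Fin 3 → ℝ}
    (hp : p ∈ layer lo hi) (hq : q ∈ layer lo hi) (h0 : q 0 = p 0) (h1 : q 1 = p 1)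
    (hz : ∀ r ∈ segment ℝ p q, fderiv ℝ f r (Pi.single 2 1) = 0) : f q = f p := by
  refine eq_of_fderiv_segment_eq_zero
    (fun r hr => hd r (segment_subset_layer_of_vertical hp hq h0 h1 hr)) fun r hr => ?_
  rw [eq_vertical_single h0 h1, map_smul, hz r hr, smul_zero]

namespace IsHorizontalVorticityFlow

variable {ρ g γ a b c₁ c₂ M : ℝ} {lo hi : (Fin 2 → ℝ) → ℝ}
  {u : (Fin 3 → ℝ) → (Fin 3 → ℝ)} {P : (Fin 3 → ℝ) → ℝ}

theorem isOpen (H : IsHorizontalVorticityFlow ρ g γ a b c₁ c₂ M lo hi u P) :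
    IsOpen (layer lo hi) :=
  isOpen_layer H.continuous_lo H.continuous_hi

theorem differentiableAt (H : IsHorizontalVorticityFlow ρ g γ a b c₁ c₂ M lo hi u P)
    {p : Fin 3 → ℝ} (hp : p ∈ layer lo hi) : DifferentiableAt ℝ u p :=
  H.euler.differentiableAt_velocity H.isOpen hp

theorem slab_subset (H : IsHorizontalVorticityFlow ρ g γ a b c₁ c₂ M lo hi u P)
    {p : Fin 3 → ℝ} (hp : p 2 ∈ Set.Ioo c₁ c₂) : p ∈ layer lo hi :=
  ⟨(H.lo_le _).trans_lt hp.1, hp.2.trans_le (H.le_hi _)⟩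

theorem hasFDerivAt_head (H : IsHorizontalVorticityFlow ρ g γ a b c₁ c₂ M lo hi u P)
    {p : Fin 3 → ℝ} (hp : p ∈ layer lo hi) :
    HasFDerivAt (bernoulliHead ρ g u P)
      (γ • (u p 2 • (a • ContinuousLinearMap.proj 1 - b • ContinuousLinearMap.proj 0)
        + transverse a b u p • ContinuousLinearMap.proj 2 : (Fin 3 → ℝ) →L[ℝ] ℝ)) p := by
  refine (H.euler.hasFDerivAt_bernoulliHead H.density_ne_zero H.isOpen hp
    (H.curl_eq p hp)).congr_fderiv ?_
  ext v
  simp only [Fin.sum_univ_three, add_apply, sub_apply, smul_apply,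
    ContinuousLinearMap.proj_apply, smul_eq_mul, cross_apply, Pi.smul_apply, transverse,
    Matrix.cons_val, Matrix.cons_val_zero, Matrix.cons_val_one]
  ring

/-- The gradient of the Bernoulli function has components `0`, `-γ w`, `γ q` along `e`, `n` and the
vertical. Mixed second derivatives commute, so the `e`-derivatives of the last two equal derivatives
of the first, which vanish. Only first derivatives of the velocity are needed. -/
theorem fderiv_axis (H : IsHorizontalVorticityFlow ρ g γ a b c₁ c₂ M lo hi u P)
    {p : Fin 3 → ℝ} (hp : p ∈ layer lo hi) :
    fderiv ℝ (fun q => u q 2) p ![a, b, 0] = 0 ∧ fderiv ℝ (transverse a b u) p ![a, b, 0] = 0 := by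
  have hu := H.differentiableAt hp
  have hw := hasFDerivAt_component hu 2
  have hq := (hasFDerivAt_transverse a b hu).differentiableAt.hasFDerivAt
  have hsym := second_derivative_symmetric_of_eventually
    (f := bernoulliHead ρ g u P)
    (Filter.mem_of_superset (H.isOpen.mem_nhds hp) fun r hr => H.hasFDerivAt_head hr)
    (((hw.smul_const (a • ContinuousLinearMap.proj 1 - b • ContinuousLinearMap.proj 0 :
      (Fin 3 → ℝ) →L[ℝ] ℝ)).add (hq.smul_const
        (ContinuousLinearMap.proj 2 : (Fin 3 → ℝ) →L[ℝ] ℝ))).const_smul γ) ![a, b, 0]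
  have h1 := hsym ![b, -a, 0]
  have h2 := hsym ![0, 0, 1]
  simp only [add_apply, sub_apply, smul_apply, ContinuousLinearMap.smulRight_apply,
    ContinuousLinearMap.proj_apply, smul_eq_mul,
    Matrix.cons_val, Matrix.cons_val_zero, Matrix.cons_val_one] at h1 h2
  have hγ := H.vorticity_ne_zero
  constructor
  · apply mul_left_cancel₀ hγ
    linear_combination -h1 - γ * fderiv ℝ (fun q => u q 2) p ![a, b, 0] * H.unit
  · apply mul_left_cancel₀ hγ
    linear_combination h2

/-- The curl and divergence equations in the frame of `e`, `n` and the vertical. In the first two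
identities `fderiv_axis` removes the derivatives of `w` and `q` along `e`. Once the axial velocity
is known to be constant, the last two become inhomogeneous Cauchy-Riemann equations for `q` and `w`.
-/
theorem fderiv_axial (H : IsHorizontalVorticityFlow ρ g γ a b c₁ c₂ M lo hi u P)
    {p : Fin 3 → ℝ} (hp : p ∈ layer lo hi) :
    fderiv ℝ (axial a b u) p (Pi.single 2 1) = 0 ∧ fderiv ℝ (axial a b u) p ![b, -a, 0] = 0 ∧
      fderiv ℝ (axial a b u) p ![a, b, 0] = -fderiv ℝ (fun q => u q 2) p (Pi.single 2 1)
        - fderiv ℝ (transverse a b u) p ![b, -a, 0] ∧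
      fderiv ℝ (transverse a b u) p (Pi.single 2 1)
        - fderiv ℝ (fun q => u q 2) p ![b, -a, 0] = γ := by
  have hu := H.differentiableAt hp
  obtain ⟨h1, h2⟩ := H.fderiv_axis hp
  have hc := H.curl_eq p hp
  have c0 := congrFun hc 0
  have c1 := congrFun hc 1
  have c2 := congrFun hc 2
  have hdiv := H.euler.incompressible p hp
  have hab := H.unit
  rw [(hasFDerivAt_axial a b hu).fderiv, (hasFDerivAt_transverse a b hu).fderiv]
  rw [(hasFDerivAt_transverse a b hu).fderiv] at h2
  simp only [Fin.sum_univ_three, add_apply, sub_apply, smul_apply, smul_eq_mul, curl,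
    fderiv_apply_eq_sum_pd, Pi.smul_apply, Matrix.cons_val, Matrix.cons_val_zero,
    Matrix.cons_val_one, Pi.single_apply, Fin.reduceEq, if_true, if_false] at *
  refine ⟨?_, ?_, ?_, ?_⟩
  · linear_combination a * c1 - b * c0 + h1
  · linear_combination h2 + (a ^ 2 + b ^ 2) * c2
  · linear_combination hdiv + (pd 0 (fun q => u q 0) p + pd 1 (fun q => u q 1) p) * hab
  · linear_combination b * c1 + a * c0 + γ * hab

/-- In the slab, a function without derivative along the axis is invariant along the axis. -/
theorem slab_invariant (H : IsHorizontalVorticityFlow ρ g γ a b c₁ c₂ M lo hi u P)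
    {f : (Fin 3 → ℝ) → ℝ} (hd : ∀ r ∈ layer lo hi, DifferentiableAt ℝ f r)
    (h0 : ∀ r ∈ layer lo hi, fderiv ℝ f r ![a, b, 0] = 0) {p : Fin 3 → ℝ}
    (hp : p 2 ∈ Set.Ioo c₁ c₂) (t : ℝ) : f (p + t • ![a, b, 0]) = f p := by
  have hseg : ∀ r ∈ segment ℝ p (p + t • ![a, b, 0]), r ∈ layer lo hi := by
    intro r hr
    rw [segment_eq_image'] at hr
    obtain ⟨s, -, rfl⟩ := hr
    exact H.slab_subset (by simpa using hp)
  refine eq_of_fderiv_segment_eq_zero (fun r hr => hd r (hseg r hr)) fun r hr => ?_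
  rw [add_sub_cancel_left, map_smul, h0 r (hseg r hr), smul_zero]

theorem slab_fderiv_invariant (H : IsHorizontalVorticityFlow ρ g γ a b c₁ c₂ M lo hi u P)
    {f : (Fin 3 → ℝ) → ℝ} (hd : ∀ r ∈ layer lo hi, DifferentiableAt ℝ f r)
    (h0 : ∀ r ∈ layer lo hi, fderiv ℝ f r ![a, b, 0] = 0) {p : Fin 3 → ℝ}
    (hp : p 2 ∈ Set.Ioo c₁ c₂) (t : ℝ) : fderiv ℝ f (p + t • ![a, b, 0]) = fderiv ℝ f p := by
  rw [← fderiv_comp_add_right]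
  refine Filter.EventuallyEq.fderiv_eq ?_
  have : ∀ᶠ r : Fin 3 → ℝ in 𝓝 p, r 2 ∈ Set.Ioo c₁ c₂ :=
    (continuous_apply 2).continuousAt.eventually (isOpen_Ioo.mem_nhds hp)
  exact this.mono fun r hr => H.slab_invariant hd h0 hr t

theorem differentiableAt_vertical (H : IsHorizontalVorticityFlow ρ g γ a b c₁ c₂ M lo hi u P) :
    ∀ r ∈ layer lo hi, DifferentiableAt ℝ (fun q => u q 2) r := fun _ hr =>
  (hasFDerivAt_component (H.differentiableAt hr) 2).differentiableAt

theorem differentiableAt_transverse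
    (H : IsHorizontalVorticityFlow ρ g γ a b c₁ c₂ M lo hi u P) :
    ∀ r ∈ layer lo hi, DifferentiableAt ℝ (transverse a b u) r := fun _ hr =>
  (hasFDerivAt_transverse a b (H.differentiableAt hr)).differentiableAt

theorem differentiableAt_axial (H : IsHorizontalVorticityFlow ρ g γ a b c₁ c₂ M lo hi u P) :
    ∀ r ∈ layer lo hi, DifferentiableAt ℝ (axial a b u) r := fun _ hr =>
  (hasFDerivAt_axial a b (H.differentiableAt hr)).differentiableAt

/-- By incompressibility this derivative is determined by derivatives of `w` and `q`, which are
invariant along the axis. The axial velocity is thus affine on a whole line, and being bounded it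
has slope zero. -/
theorem slab_fderiv_axial_axis (H : IsHorizontalVorticityFlow ρ g γ a b c₁ c₂ M lo hi u P)
    {p : Fin 3 → ℝ} (hp : p 2 ∈ Set.Ioo c₁ c₂) : fderiv ℝ (axial a b u) p ![a, b, 0] = 0 := by
  set k := fderiv ℝ (axial a b u) p ![a, b, 0] with hk
  have hslab : ∀ t : ℝ, (p + t • ![a, b, 0]) 2 ∈ Set.Ioo c₁ c₂ := fun t => by simpa using hp
  have hconst : ∀ t : ℝ, fderiv ℝ (axial a b u) (p + t • ![a, b, 0]) ![a, b, 0] = k := by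
    intro t
    rw [hk, (H.fderiv_axial (H.slab_subset (hslab t))).2.2.1,
      (H.fderiv_axial (H.slab_subset hp)).2.2.1,
      H.slab_fderiv_invariant H.differentiableAt_vertical (fun r hr => (H.fderiv_axis hr).1) hp,
      H.slab_fderiv_invariant H.differentiableAt_transverse (fun r hr => (H.fderiv_axis hr).2) hp]
  have hlin : ∀ t : ℝ, axial a b u (p + t • ![a, b, 0]) - axial a b u p = t * k := by
    intro t
    have hseg : ∀ r ∈ segment ℝ p (p + t • ![a, b, 0]), ∃ s : ℝ, r = p + s • ![a, b, 0] := by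
      intro r hr
      rw [segment_eq_image'] at hr
      obtain ⟨s, -, rfl⟩ := hr
      exact ⟨s * t, by simp only [add_sub_cancel_left, smul_smul]⟩
    obtain ⟨z, hz, h⟩ := domain_mvt (f := axial a b u) (f' := fderiv ℝ (axial a b u)) (fun r hr => by
        obtain ⟨s, rfl⟩ := hseg r hr
        exact (H.differentiableAt_axial _
          (H.slab_subset (hslab s))).hasFDerivAt.hasFDerivWithinAt)
      (convex_segment _ _) (left_mem_segment ℝ p (p + t • ![a, b, 0]))
      (right_mem_segment ℝ p (p + t • ![a, b, 0]))
    obtain ⟨s, rfl⟩ := hseg z hz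
    rw [h, add_sub_cancel_left, map_smul, hconst, smul_eq_mul]
  have hbd : ∀ r : Fin 3 → ℝ, r ∈ layer lo hi → |axial a b u r| ≤ (|a| + |b|) * M := by
    intro r hr
    have h0 : |u r 0| ≤ M := (norm_le_pi_norm (u r) 0).trans (H.bound r hr)
    have h1 : |u r 1| ≤ M := (norm_le_pi_norm (u r) 1).trans (H.bound r hr)
    calc |axial a b u r| ≤ |a * u r 0| + |b * u r 1| := abs_add_le _ _
      _ = |a| * |u r 0| + |b| * |u r 1| := by rw [abs_mul, abs_mul]
      _ ≤ |a| * M + |b| * M := by gcongr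
      _ = _ := by ring
  by_contra hne
  -- At this displacement the axial velocity would change by one more than twice its bound.
  have h1 := hlin ((2 * ((|a| + |b|) * M) + 1) / k)
  rw [div_mul_cancel₀ _ hne] at h1
  have h2 := abs_le.1 (hbd _ (H.slab_subset (hslab ((2 * ((|a| + |b|) * M) + 1) / k))))
  have h3 := abs_le.1 (hbd _ (H.slab_subset hp))
  linarith [h2.2, h3.1]

/-- The velocity component along the vorticity is constant. -/
theorem exists_axial_eq (H : IsHorizontalVorticityFlow ρ g γ a b c₁ c₂ M lo hi u P) :
    ∃ V : ℝ, ∀ p ∈ layer lo hi, axial a b u p = V := by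
  have hc : (c₁ + c₂) / 2 ∈ Set.Ioo c₁ c₂ := ⟨by linarith [H.slab], by linarith [H.slab]⟩
  set o : Fin 3 → ℝ := ![0, 0, (c₁ + c₂) / 2]
  have ho : o 2 ∈ Set.Ioo c₁ c₂ := hc
  have hgrad : ∀ p : Fin 3 → ℝ, p 2 ∈ Set.Ioo c₁ c₂ → ∀ v, fderiv ℝ (axial a b u) p v = 0 := by
    intro p hp v
    have hv : v = (a * v 0 + b * v 1) • ![a, b, 0] + (b * v 0 - a * v 1) • ![b, -a, 0]
        + v 2 • (Pi.single 2 1 : Fin 3 → ℝ) := by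
      have hab := H.unit
      ext i
      fin_cases i
      · simp; linear_combination -v 0 * hab
      · simp; linear_combination -v 1 * hab
      · simp
    obtain ⟨h1, h2, -⟩ := H.fderiv_axial (H.slab_subset hp)
    rw [hv, map_add, map_add, map_smul, map_smul, map_smul, h1, h2, H.slab_fderiv_axial_axis hp]
    simp
  refine ⟨axial a b u o, fun p hp => ?_⟩
  set q : Fin 3 → ℝ := ![p 0, p 1, (c₁ + c₂) / 2]
  have hq : q 2 ∈ Set.Ioo c₁ c₂ := hc
  -- Vertical segments stay in the layer, so any point can be moved into the slab without changing
  -- the axial velocity.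
  have h1 : axial a b u p = axial a b u q := by
    refine eq_of_vertical H.differentiableAt_axial (H.slab_subset hq) hp rfl rfl fun r hr => ?_
    exact (H.fderiv_axial
      (segment_subset_layer_of_vertical (H.slab_subset hq) hp rfl rfl hr)).1
  have hseg : ∀ r ∈ segment ℝ o q, r 2 ∈ Set.Ioo c₁ c₂ := by
    rintro r ⟨s, t, hs, ht, hst, rfl⟩
    exact convex_Ioo c₁ c₂ ho hq hs ht hst
  rw [h1]
  exact eq_of_fderiv_segment_eq_zero
    (fun r hr => H.differentiableAt_axial r (H.slab_subset (hseg r hr)))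
    fun r hr => hgrad r (hseg r hr) _

theorem fderiv_axial_eq_zero (H : IsHorizontalVorticityFlow ρ g γ a b c₁ c₂ M lo hi u P)
    {p : Fin 3 → ℝ} (hp : p ∈ layer lo hi) : fderiv ℝ (axial a b u) p = 0 := by
  obtain ⟨V, hV⟩ := H.exists_axial_eq
  have : axial a b u =ᶠ[𝓝 p] fun _ => V :=
    Filter.mem_of_superset (H.isOpen.mem_nhds hp) hV
  rw [this.fderiv_eq, fderiv_const_apply]

end IsHorizontalVorticityFlow

/-! ### Complex velocity and invariance throughout the layer -/

/-- The vertical plane through `o` orthogonal to `(a, b, 0)`, parametrized by complex numbers. -/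
noncomputable def verticalSlice (a b : ℝ) (o : Fin 3 → ℝ) (ζ : ℂ) : Fin 3 → ℝ :=
  o + (ζ.re • ![b, -a, 0] + ζ.im • Pi.single 2 1)

theorem hasFDerivAt_verticalSlice (a b : ℝ) (o : Fin 3 → ℝ) (ζ : ℂ) :
    HasFDerivAt (verticalSlice a b o)
      (Complex.reCLM.smulRight ![b, -a, 0] + Complex.imCLM.smulRight (Pi.single 2 1)) ζ :=
  ((Complex.reCLM.smulRight ![b, -a, 0]
    + Complex.imCLM.smulRight (Pi.single 2 1 : Fin 3 → ℝ)).hasFDerivAt).const_add o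

/-- The complex velocity in a vertical slice, corrected by the shear flow of vorticity `γ`. -/
noncomputable def complexVelocity (a b γ : ℝ) (u : (Fin 3 → ℝ) → (Fin 3 → ℝ)) (o : Fin 3 → ℝ)
    (ζ : ℂ) : ℂ :=
  ((transverse a b u (verticalSlice a b o ζ) - γ * ζ.im : ℝ) : ℂ)
    - (u (verticalSlice a b o ζ) 2 : ℂ) * Complex.I

/-- The point on the vertical line through `q` that divides the way to height `c` in ratio `s`. -/
noncomputable def verticalShift (c : ℝ) (q : Fin 3 → ℝ) (s : ℝ) : Fin 3 → ℝ :=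
  q + (s * (c - q 2)) • Pi.single 2 1

theorem verticalShift_zero (c : ℝ) (q : Fin 3 → ℝ) : verticalShift c q 0 = q := by
  simp [verticalShift]

theorem verticalShift_add (c : ℝ) (q : Fin 3 → ℝ) {e : Fin 3 → ℝ} (he : e 2 = 0) (s : ℝ) :
    verticalShift c (q + e) s = verticalShift c q s + e := by
  simp only [verticalShift, Pi.add_apply, he, add_zero]; abel

theorem hasDerivAt_verticalShift (c : ℝ) (q : Fin 3 → ℝ) (s : ℝ) :
    HasDerivAt (verticalShift c q) ((c - q 2) • Pi.single 2 1) s := by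
  have h := (((hasDerivAt_id s).mul_const (c - q 2)).smul_const
    (Pi.single 2 1 : Fin 3 → ℝ)).const_add q
  rwa [one_mul] at h

theorem tendsto_verticalShift (c : ℝ) (q : Fin 3 → ℝ) :
    Tendsto (verticalShift c q) (𝓝[>] 0) (𝓝 q) := by
  have := (hasDerivAt_verticalShift c q 0).continuousAt.tendsto
  rw [verticalShift_zero] at this
  exact this.mono_left nhdsWithin_le_nhds

namespace IsHorizontalVorticityFlow

variable {ρ g γ a b c₁ c₂ M : ℝ} {lo hi : (Fin 2 → ℝ) → ℝ}
  {u : (Fin 3 → ℝ) → (Fin 3 → ℝ)} {P : (Fin 3 → ℝ) → ℝ}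

/-- With constant axial velocity, `∂ₙq + ∂_z w = 0` and `∂_z q - ∂ₙw = γ`. Subtracting the shear `γ
z` from `q` turns these into the Cauchy-Riemann equations. -/
theorem differentiableAt_complexVelocity
    (H : IsHorizontalVorticityFlow ρ g γ a b c₁ c₂ M lo hi u P) {o : Fin 3 → ℝ} {ζ : ℂ}
    (hζ : verticalSlice a b o ζ ∈ layer lo hi) :
    DifferentiableAt ℂ (complexVelocity a b γ u o) ζ := by
  have hS := hasFDerivAt_verticalSlice a b o ζ
  have hq := HasFDerivAt.comp (g := transverse a b u) ζ
    (H.differentiableAt_transverse _ hζ).hasFDerivAt hS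
  have hw := HasFDerivAt.comp (g := fun q => u q 2) ζ
    (H.differentiableAt_vertical _ hζ).hasFDerivAt hS
  have hF : HasFDerivAt (complexVelocity a b γ u o) _ ζ :=
    (Complex.ofRealCLM.hasFDerivAt.comp ζ (hq.sub (Complex.imCLM.hasFDerivAt.const_mul γ))).sub
      ((Complex.ofRealCLM.hasFDerivAt.comp ζ hw).mul_const Complex.I)
  refine differentiableAt_complex_iff_differentiableAt_real.2 ⟨hF.differentiableAt, ?_⟩
  obtain ⟨-, -, h1, h2⟩ := H.fderiv_axial hζ
  rw [H.fderiv_axial_eq_zero hζ, zero_apply] at h1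
  rw [hF.fderiv]
  apply Complex.ext
  · simp
    linarith
  · simp
    linarith

theorem analyticAt_complexVelocity
    (H : IsHorizontalVorticityFlow ρ g γ a b c₁ c₂ M lo hi u P) {o : Fin 3 → ℝ} {ζ : ℂ}
    (hζ : verticalSlice a b o ζ ∈ layer lo hi) :
    AnalyticAt ℂ (complexVelocity a b γ u o) ζ := by
  have hcont : Continuous (verticalSlice a b o) :=
    continuous_iff_continuousAt.2 fun ζ => (hasFDerivAt_verticalSlice a b o ζ).continuousAt
  refine DifferentiableOn.analyticAt (s := verticalSlice a b o ⁻¹' layer lo hi)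
    (fun ξ hξ => (H.differentiableAt_complexVelocity hξ).differentiableWithinAt)
    ((H.isOpen.preimage hcont).mem_nhds hζ)

/-- The transverse and vertical velocities do not vary along the axis, even between points that
are not joined by a segment in the layer. -/
theorem velocity_components_invariant
    (H : IsHorizontalVorticityFlow ρ g γ a b c₁ c₂ M lo hi u P) {p : Fin 3 → ℝ} {t : ℝ}
    (hp : p ∈ layer lo hi) (hpt : p + t • ![a, b, 0] ∈ layer lo hi) :
    transverse a b u (p + t • ![a, b, 0]) = transverse a b u p ∧
      u (p + t • ![a, b, 0]) 2 = u p 2 := by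
  -- Base height `0` makes the imaginary part of the slice parameter equal to the height; `o` itself
  -- need not lie in the layer.
  set o : Fin 3 → ℝ := ![p 0, p 1, 0] with ho
  have hslice : ∀ z : ℝ, verticalSlice a b o (z * Complex.I) = ![p 0, p 1, z] := by
    intro z
    ext i; fin_cases i <;> simp [verticalSlice, o]
  have hshift : ∀ ζ : ℂ, verticalSlice a b (o + t • ![a, b, 0]) ζ
      = verticalSlice a b o ζ + t • ![a, b, 0] := fun ζ => by
    simp only [verticalSlice]; abel
  have himage : ∀ ζ : ℂ, ζ.re = 0 → ζ = ζ.im * Complex.I := fun ζ h => by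
    apply Complex.ext <;> simp [h]
  set c := (c₁ + c₂) / 2 with hc
  have hcI : c ∈ Set.Ioo c₁ c₂ := ⟨by linarith [H.slab], by linarith [H.slab]⟩
  -- Identity theorem along the vertical segment from slab height `c` to the height of `p`; it lies
  -- in the layer both below or above `p` and in the translated slice.
  set K : Set ℂ := (fun z : ℝ => (z : ℂ) * Complex.I) '' Set.uIcc c (p 2) with hK
  have hpre : IsPreconnected K :=
    isPreconnected_uIcc.image _ (by fun_prop)
  have hvert : ∀ {q : Fin 3 → ℝ}, q ∈ layer lo hi → ∀ z ∈ Set.uIcc c (q 2),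
      ![q 0, q 1, z] ∈ layer lo hi := by
    intro q hq z hz
    have hcq := H.slab_subset (p := ![q 0, q 1, c]) hcI
    have := (Set.ordConnected_Ioo (a := lo ![q 0, q 1]) (b := hi ![q 0, q 1])).uIcc_subset
      hcq hq hz
    exact this
  have h1 : AnalyticOnNhd ℂ (complexVelocity a b γ u o) K := by
    rintro _ ⟨z, hz, rfl⟩
    refine H.analyticAt_complexVelocity ?_
    rw [hslice]
    exact hvert hp z hz
  have h2 : AnalyticOnNhd ℂ (complexVelocity a b γ u (o + t • ![a, b, 0])) K := by
    rintro _ ⟨z, hz, rfl⟩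
    refine H.analyticAt_complexVelocity ?_
    rw [hshift, hslice]
    have := hvert hpt z (by simpa using hz)
    convert this using 1
    ext i; fin_cases i <;> simp
  have hev : complexVelocity a b γ u (o + t • ![a, b, 0])
      =ᶠ[𝓝 ((c : ℂ) * Complex.I)] complexVelocity a b γ u o := by
    have : ∀ᶠ ζ : ℂ in 𝓝 ((c : ℂ) * Complex.I), ζ.im ∈ Set.Ioo c₁ c₂ :=
      Complex.continuous_im.continuousAt.eventually (isOpen_Ioo.mem_nhds (by simpa using hcI))
    refine this.mono fun ζ hζ => ?_
    have hs : verticalSlice a b o ζ 2 ∈ Set.Ioo c₁ c₂ := by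
      have : verticalSlice a b o ζ 2 = ζ.im := by
        change (0 : ℝ) + (ζ.re * 0 + ζ.im * (Pi.single 2 1 : Fin 3 → ℝ) 2) = ζ.im
        simp
      rwa [this]
    simp only [complexVelocity, hshift]
    rw [H.slab_invariant H.differentiableAt_transverse (fun r hr => (H.fderiv_axis hr).2) hs,
      H.slab_invariant (f := fun q => u q 2) H.differentiableAt_vertical
        (fun r hr => (H.fderiv_axis hr).1) hs]
  have heq := h2.eqOn_of_preconnected_of_eventuallyEq h1 hpre
    (Set.mem_image_of_mem _ Set.left_mem_uIcc) hev (Set.mem_image_of_mem _ Set.right_mem_uIcc)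
  have hpp : ![p 0, p 1, p 2] = p := by ext i; fin_cases i <;> rfl
  simp only [complexVelocity, hshift, hslice, hpp] at heq
  generalize p + t • ![a, b, 0] = r at heq ⊢
  have hre := congrArg Complex.re heq
  have him := congrArg Complex.im heq
  simp at hre him
  exact ⟨hre, him⟩

theorem velocity_invariant (H : IsHorizontalVorticityFlow ρ g γ a b c₁ c₂ M lo hi u P)
    {p : Fin 3 → ℝ} {t : ℝ} (hp : p ∈ layer lo hi) (hpt : p + t • ![a, b, 0] ∈ layer lo hi) :
    u (p + t • ![a, b, 0]) = u p := by
  obtain ⟨V, hV⟩ := H.exists_axial_eq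
  obtain ⟨h1, h2⟩ := H.velocity_components_invariant hp hpt
  rw [velocity_eq H.unit u p, velocity_eq H.unit u (p + t • ![a, b, 0]), h1, h2, hV p hp,
    hV _ hpt]

/-- The vertical derivative of the Bernoulli function is `γ q`, already known to be invariant. So
the difference between its values on two aligned vertical lines is constant, and it is zero in the
slab. Removing gravity and kinetic energy leaves the pressure. -/
theorem pressure_invariant (H : IsHorizontalVorticityFlow ρ g γ a b c₁ c₂ M lo hi u P)
    {p : Fin 3 → ℝ} {t : ℝ} (hp : p ∈ layer lo hi) (hpt : p + t • ![a, b, 0] ∈ layer lo hi) :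
    P (p + t • ![a, b, 0]) = P p := by
  set B := bernoulliHead ρ g u P with hB
  set e : Fin 3 → ℝ := ![a, b, 0] with he
  have hBd : ∀ r ∈ layer lo hi, DifferentiableAt ℝ B r := fun r hr =>
    (H.hasFDerivAt_head hr).differentiableAt
  have hBe : ∀ r ∈ layer lo hi, fderiv ℝ B r e = 0 := by
    intro r hr
    rw [(H.hasFDerivAt_head hr).fderiv]
    simp [e]
    right
    right
    ring
  have hBz : ∀ r ∈ layer lo hi, fderiv ℝ B r (Pi.single 2 1) = γ * transverse a b u r := by
    intro r hr
    rw [(H.hasFDerivAt_head hr).fderiv]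
    simp
  set q : Fin 3 → ℝ := ![p 0, p 1, (c₁ + c₂) / 2] with hq
  have hqI : q 2 ∈ Set.Ioo c₁ c₂ := by
    constructor
    · simp [q]; linarith [H.slab]
    · simp [q]; linarith [H.slab]
  have hqt : q + t • e ∈ layer lo hi := H.slab_subset (by simpa [e] using hqI)
  have hseg : ∀ r ∈ segment ℝ q p, r ∈ layer lo hi ∧ r + t • e ∈ layer lo hi := by
    intro r hr
    refine ⟨segment_subset_layer_of_vertical (H.slab_subset hqI) hp rfl rfl hr, ?_⟩
    refine segment_subset_layer_of_vertical hqt hpt (by simp [q]) (by simp [q]) ?_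
    have := (mem_segment_translate ℝ (t • e) (x := r) (b := q) (c := p)).2 hr
    simpa only [add_comm (t • e)] using this
  have hdiff : B (p + t • e) - B p = B (q + t • e) - B q := by
    refine eq_of_fderiv_segment_eq_zero (f := fun r => B (r + t • e) - B r) (fun r hr => ?_)
      fun r hr => ?_
    · exact ((differentiableAt_comp_add_right (t • e)).2 (hBd _ (hseg r hr).2)).sub
        (hBd _ (hseg r hr).1)
    · rw [fderiv_fun_sub ((differentiableAt_comp_add_right (t • e)).2 (hBd _ (hseg r hr).2))
        (hBd _ (hseg r hr).1), fderiv_comp_add_right,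
        eq_vertical_single (p := q) (q := p) rfl rfl, sub_apply, map_smul, map_smul,
        hBz _ (hseg r hr).2, hBz _ (hseg r hr).1,
        (H.velocity_components_invariant (hseg r hr).1 (hseg r hr).2).1, sub_self]
  rw [H.slab_invariant hBd hBe hqI t, sub_self, sub_eq_zero] at hdiff
  have hv : u (p + t • e) = u p := H.velocity_invariant hp hpt
  have hz : (p + t • e) 2 = p 2 := by simp [e]
  simp only [hB, bernoulliHead, hv, hz] at hdiff
  have hρ := H.density_ne_zero
  apply mul_left_cancel₀ (inv_ne_zero hρ)
  linarith

/-! ### Extension to the closed layer -/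

theorem verticalShift_mem_layer (H : IsHorizontalVorticityFlow ρ g γ a b c₁ c₂ M lo hi u P)
    {c s : ℝ} (hc : c ∈ Set.Ioo c₁ c₂) (hs : s ∈ Set.Ioo (0 : ℝ) 1) {q : Fin 3 → ℝ}
    (h1 : lo ![q 0, q 1] ≤ q 2) (h2 : q 2 ≤ hi ![q 0, q 1]) : verticalShift c q s ∈ layer lo hi := by
  have e0 : verticalShift c q s 0 = q 0 := by simp [verticalShift]
  have e1 : verticalShift c q s 1 = q 1 := by simp [verticalShift]
  have e2 : verticalShift c q s 2 = (1 - s) * q 2 + s * c := by simp [verticalShift]; ring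
  have l1 := (H.lo_le ![q 0, q 1]).trans_lt hc.1
  have l2 := hc.2.trans_le (H.le_hi ![q 0, q 1])
  have hs' : 0 ≤ 1 - s := by linarith [hs.2]
  constructor
  · rw [e0, e1, e2]
    linarith [mul_le_mul_of_nonneg_left h1 hs', mul_lt_mul_of_pos_left l1 hs.1]
  · rw [e0, e1, e2]
    linarith [mul_le_mul_of_nonneg_left h2 hs', mul_lt_mul_of_pos_left l2 hs.1]

theorem mem_closure_iff (H : IsHorizontalVorticityFlow ρ g γ a b c₁ c₂ M lo hi u P)
    {q : Fin 3 → ℝ} :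
    q ∈ closure (layer lo hi) ↔ lo ![q 0, q 1] ≤ q 2 ∧ q 2 ≤ hi ![q 0, q 1] := by
  refine ⟨fun h => closure_layer_subset H.continuous_lo H.continuous_hi h, fun h => ?_⟩
  obtain ⟨c, hc⟩ := Set.nonempty_Ioo.2 H.slab
  refine mem_closure_of_tendsto (tendsto_verticalShift c q) ?_
  filter_upwards [Ioo_mem_nhdsGT (zero_lt_one' ℝ)] with s hs
  exact H.verticalShift_mem_layer hc hs h.1 h.2

/-- A continuous map on the closed layer that is invariant under a horizontal translation in the
layer is invariant under it in the closed layer. -/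
theorem closure_invariant (H : IsHorizontalVorticityFlow ρ g γ a b c₁ c₂ M lo hi u P)
    {F : Type*} [TopologicalSpace F] [T2Space F] {f : (Fin 3 → ℝ) → F}
    (hf : ContinuousOn f (closure (layer lo hi))) {e : Fin 3 → ℝ} (he : e 2 = 0)
    (hinv : ∀ p ∈ layer lo hi, p + e ∈ layer lo hi → f (p + e) = f p) {p : Fin 3 → ℝ}
    (hp : p ∈ closure (layer lo hi)) (hpe : p + e ∈ closure (layer lo hi)) :
    f (p + e) = f p := by
  obtain ⟨c, hc⟩ := Set.nonempty_Ioo.2 H.slab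
  have hT : ∀ q ∈ closure (layer lo hi), ∀ s ∈ Set.Ioo (0 : ℝ) 1,
      verticalShift c q s ∈ layer lo hi := fun q hq s hs =>
    H.verticalShift_mem_layer hc hs (H.mem_closure_iff.1 hq).1 (H.mem_closure_iff.1 hq).2
  have hlim : ∀ q ∈ closure (layer lo hi),
      Tendsto (fun s => f (verticalShift c q s)) (𝓝[>] 0) (𝓝 (f q)) := by
    intro q hq
    refine (hf q hq).tendsto.comp (tendsto_nhdsWithin_iff.2 ⟨tendsto_verticalShift c q, ?_⟩)
    filter_upwards [Ioo_mem_nhdsGT (zero_lt_one' ℝ)] with s hs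
    exact subset_closure (hT q hq s hs)
  refine tendsto_nhds_unique (hlim _ hpe) ((hlim p hp).congr' ?_)
  filter_upwards [Ioo_mem_nhdsGT (zero_lt_one' ℝ)] with s hs
  have := hT _ hpe s hs
  rw [verticalShift_add c p he s] at this ⊢
  exact (hinv _ (hT p hp s hs) this).symm

theorem isTwoDimensionalFlow (H : IsHorizontalVorticityFlow ρ g γ a b c₁ c₂ M lo hi u P) :
    IsTwoDimensionalFlow ![a, b, 0] (closure (layer lo hi)) u P := by
  have hu := H.euler.contDiffOn_velocity.continuousOn
  refine ⟨fun p hp t hpt => ⟨?_, ?_⟩, ?_⟩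
  · exact H.closure_invariant hu (by simp) (fun q hq hqt => H.velocity_invariant hq hqt) hp hpt
  · exact H.closure_invariant H.euler.contDiffOn_pressure.continuousOn (by simp)
      (fun q hq hqt => H.pressure_invariant hq hqt) hp hpt
  · obtain ⟨V, hV⟩ := H.exists_axial_eq
    refine ⟨V, fun p hp => ?_⟩
    have hcont : ContinuousOn (fun p => u p ⬝ᵥ ![a, b, 0]) (closure (layer lo hi)) := by
      simp only [dotProduct, Fin.sum_univ_three]
      fun_prop
    refine Set.EqOn.of_subset_closure (s := layer lo hi) (g := fun _ => V) (fun q hq => ?_) hcont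
      continuousOn_const subset_closure subset_rfl hp
    rw [← hV q hq]
    simp [dotProduct, Fin.sum_univ_three, axial]
    ring

/-- The one-sided vertical derivative of the pressure at a boundary point equals the vertical
derivative at any aligned interior point. -/
theorem pdWithin_pressure_eq (H : IsHorizontalVorticityFlow ρ g γ a b c₁ c₂ M lo hi u P)
    {p : Fin 3 → ℝ} {t : ℝ} (hp : p ∈ closure (layer lo hi))
    (hpt : p + t • ![a, b, 0] ∈ layer lo hi) :
    pdWithin (closure (layer lo hi)) 2 P p = pd 2 P (p + t • ![a, b, 0]) := by
  -- The target height must differ from that of `p`, so that the factor `c - p 2` can be cancelled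
  -- at the end.
  obtain ⟨c, hc, hne⟩ : ∃ c ∈ Set.Ioo c₁ c₂, c ≠ p 2 :=
    (Set.Ioo_infinite H.slab).exists_notMem_finset {p 2} |>.imp fun c h => by simpa using h
  set p' := p + t • ![a, b, 0] with hp'
  have hmaps : ∀ q ∈ closure (layer lo hi), Set.MapsTo (verticalShift c q) (Set.Ico 0 1)
      (closure (layer lo hi)) := by
    intro q hq s hs
    rcases hs.1.eq_or_lt with rfl | h0
    · rwa [verticalShift_zero]
    · exact subset_closure (H.verticalShift_mem_layer hc ⟨h0, hs.2⟩ (H.mem_closure_iff.1 hq).1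
        (H.mem_closure_iff.1 hq).2)
  -- The vertical path from `p` into the slab stays in the closed layer, so its one-sided derivative
  -- fixes the value of `fderivWithin` in this direction.
  have h1 : HasDerivWithinAt (fun s => P (verticalShift c p s))
      (fderivWithin ℝ P (closure (layer lo hi)) p ((c - p 2) • Pi.single 2 1)) (Set.Ico 0 1) 0 :=
    HasFDerivWithinAt.comp_hasDerivWithinAt_of_eq (l := P) 0
      ((H.euler.contDiffOn_pressure.differentiableOn one_ne_zero) p hp).hasFDerivWithinAt
      (hasDerivAt_verticalShift c p 0).hasDerivWithinAt (hmaps p hp) (verticalShift_zero c p).symm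
  have h2 : HasDerivAt (fun s => P (verticalShift c p' s))
      (fderiv ℝ P p' ((c - p' 2) • Pi.single 2 1)) 0 :=
    HasFDerivAt.comp_hasDerivAt_of_eq (l := P) 0
      (H.euler.differentiableAt_pressure H.isOpen hpt).hasFDerivAt
      (hasDerivAt_verticalShift c p' 0) (verticalShift_zero c p').symm
  have hp2 : p' 2 = p 2 := by rw [hp', Pi.add_apply]; simp
  have h3 : HasDerivWithinAt (fun s => P (verticalShift c p s))
      (fderiv ℝ P p' ((c - p' 2) • Pi.single 2 1)) (Set.Ico 0 1) 0 := by
    refine h2.hasDerivWithinAt.congr_of_mem (fun s hs => ?_) (by simp)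
    have e := verticalShift_add c p (e := t • ![a, b, 0]) (by simp) s
    have hm := hmaps p' (subset_closure hpt) hs
    rw [hp', e] at hm ⊢
    exact (H.isTwoDimensionalFlow.1 _ (hmaps p hp hs) t hm).2.symm
  have h4 := (uniqueDiffOn_Ico (0 : ℝ) 1 0 (by simp)).eq_deriv _ h1 h3
  rw [hp2, map_smul, map_smul, smul_eq_mul, smul_eq_mul] at h4
  exact mul_left_cancel₀ (sub_ne_zero.2 hne) h4

end IsHorizontalVorticityFlow

/-! ### Maximum principle for the mean curvature operator -/

/-- A positive second derivative would make the maximum also a local minimum, so `f` would be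
locally constant and its second derivative zero. -/
theorem deriv_eq_zero_and_second_deriv_nonpos_of_max {f f' : ℝ → ℝ} {f'' : ℝ}
    (hf : ∀ s, HasDerivAt f (f' s) s) (hf' : HasDerivAt f' f'' 0) (hmax : ∀ s, f s ≤ f 0) :
    f' 0 = 0 ∧ f'' ≤ 0 := by
  have hd : deriv f = f' := funext fun s => (hf s).deriv
  have hloc : IsLocalMax f 0 := Eventually.of_forall hmax
  have h0 : f' 0 = 0 := hloc.hasDerivAt_eq_zero (hf 0)
  refine ⟨h0, ?_⟩
  by_contra! hpos
  have hmin : IsLocalMin f 0 := isLocalMin_of_deriv_deriv_pos (by rwa [hd, hf'.deriv])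
    (by rw [hd, h0]) (hf 0).continuousAt
  have hconst : f =ᶠ[𝓝 0] fun _ => f 0 := hmin.mono fun s hs => le_antisymm (hmax s) hs
  have hconst' := hconst.deriv.deriv_eq
  rw [hd, hf'.deriv] at hconst'
  simp at hconst'
  exact hpos.ne' hconst'

/-- The mean curvature of a graph in terms of its gradient `(p, q)` and Hessian `(r, s, t)`. -/
noncomputable def curvatureForm (p q r s t : ℝ) : ℝ :=
  ((1 + q ^ 2) * r - 2 * p * q * s + (1 + p ^ 2) * t) / (1 + p ^ 2 + q ^ 2) ^ (3 / 2 : ℝ)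

theorem meanCurvature_eq (η : (Fin 2 → ℝ) → ℝ) (x : Fin 2 → ℝ) :
    meanCurvature η x = curvatureForm (pd 0 η x) (pd 1 η x) (pd 0 (pd 0 η) x) (pd 1 (pd 0 η) x)
      (pd 1 (pd 1 η) x) := rfl

/-- Uniform continuity on a compact ball. At a penalized maximum the two gradients agree only
approximately, and this absorbs the error. -/
theorem curvatureForm_uniform (M ε : ℝ) (hε : 0 < ε) : ∃ θ > 0, ∀ p q p' q' r s t : ℝ,
    |p| ≤ M → |q| ≤ M → |p'| ≤ M → |q'| ≤ M → |r| ≤ M → |s| ≤ M → |t| ≤ M →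
    |p - p'| < θ → |q - q'| < θ → |curvatureForm p q r s t - curvatureForm p' q' r s t| < ε := by
  let Φ : ℝ × ℝ × ℝ × ℝ × ℝ → ℝ := fun v => curvatureForm v.1 v.2.1 v.2.2.1 v.2.2.2.1 v.2.2.2.2
  have hΦ : Continuous Φ := by
    refine Continuous.div (by fun_prop) ?_ fun v => ?_
    · refine Continuous.rpow_const (by fun_prop) fun v => Or.inl ?_
      positivity
    · positivity
  have huc := (isCompact_closedBall (0 : ℝ × ℝ × ℝ × ℝ × ℝ) M).uniformContinuousOn_of_continuous
    hΦ.continuousOn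
  obtain ⟨θ, hθ, h⟩ := Metric.uniformContinuousOn_iff.1 huc ε hε
  refine ⟨θ, hθ, fun p q p' q' r s t hp hq hp' hq' hr hs ht h1 h2 => ?_⟩
  have := h (p, q, r, s, t) (by simp [Prod.norm_def, *]) (p', q', r, s, t)
    (by simp [Prod.norm_def, *]) (by simp [Prod.dist_eq, Real.dist_eq, *])
  simpa [Real.dist_eq, Φ] using this

/-- The numerator is the sum of the values of the Hessian form at `(1, 0)`, `(0, 1)` and `(q, -p)`.
For the difference this is at most `κ (2 + p² + q²)`, and the denominator is at least `1 + p² + q²`.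
-/
theorem curvatureForm_sub_le {p q r s t r' s' t' κ : ℝ} (hκ : 0 ≤ κ)
    (h : ∀ v w : ℝ, v ^ 2 * (r - r') + 2 * v * w * (s - s') + w ^ 2 * (t - t')
      ≤ κ * (v ^ 2 + w ^ 2)) :
    curvatureForm p q r s t - curvatureForm p q r' s' t' ≤ 2 * κ := by
  have h1 := h 1 0
  have h2 := h 0 1
  have h3 := h q (-p)
  have hW : 1 ≤ 1 + p ^ 2 + q ^ 2 := by nlinarith [sq_nonneg p, sq_nonneg q]
  have hW' : 1 + p ^ 2 + q ^ 2 ≤ (1 + p ^ 2 + q ^ 2) ^ (3 / 2 : ℝ) := by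
    conv_lhs => rw [← Real.rpow_one (1 + p ^ 2 + q ^ 2)]
    exact Real.rpow_le_rpow_of_exponent_le hW (by norm_num)
  rw [curvatureForm, curvatureForm, ← sub_div, div_le_iff₀ (by linarith)]
  calc _ ≤ 2 * κ * (1 + p ^ 2 + q ^ 2) := by
        nlinarith [mul_nonneg hκ (sq_nonneg p), mul_nonneg hκ (sq_nonneg q)]
    _ ≤ _ := by gcongr

theorem hasDerivAt_line {f : (Fin 2 → ℝ) → ℝ} (hf : ContDiff ℝ 2 f) (x v : Fin 2 → ℝ) (s : ℝ) :
    HasDerivAt (fun s : ℝ => f (x + s • v)) (fderiv ℝ f (x + s • v) v) s := by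
  have hl : HasDerivAt (fun s : ℝ => x + s • v) v s := by
    simpa using ((hasDerivAt_id s).smul_const v).const_add x
  exact HasFDerivAt.comp_hasDerivAt (l := f) s
    (hf.differentiable two_ne_zero _).hasFDerivAt hl

theorem differentiable_fderiv {f : (Fin 2 → ℝ) → ℝ} (hf : ContDiff ℝ 2 f) :
    Differentiable ℝ (fderiv ℝ f) :=
  (hf.fderiv_right (m := 1) (by norm_num)).differentiable one_ne_zero

theorem hasDerivAt_fderiv_line {f : (Fin 2 → ℝ) → ℝ} (hf : ContDiff ℝ 2 f) (x v : Fin 2 → ℝ) :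
    HasDerivAt (fun s : ℝ => fderiv ℝ f (x + s • v) v) (fderiv ℝ (fderiv ℝ f) x v v) 0 := by
  have hl : HasDerivAt (fun s : ℝ => x + s • v) v 0 := by
    simpa using ((hasDerivAt_id (0 : ℝ)).smul_const v).const_add x
  have h := HasFDerivAt.comp_hasDerivAt_of_eq (l := fderiv ℝ f) (y := x) 0
    (differentiable_fderiv hf x).hasFDerivAt hl (by simp)
  simpa using h.clm_apply (hasDerivAt_const (0 : ℝ) v)

theorem pd_pd_eq {f : (Fin 2 → ℝ) → ℝ} (hf : ContDiff ℝ 2 f) (i j : Fin 2) (x : Fin 2 → ℝ) :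
    pd i (pd j f) x = fderiv ℝ (fderiv ℝ f) x (Pi.single i 1) (Pi.single j 1) := by
  have := ((differentiable_fderiv hf x).hasFDerivAt.clm_apply
    (hasFDerivAt_const (Pi.single j 1 : Fin 2 → ℝ) x)).fderiv
  unfold pd
  rw [this]
  simp

theorem hessian_apply_self {f : (Fin 2 → ℝ) → ℝ} (hf : ContDiff ℝ 2 f) (x : Fin 2 → ℝ) (v w : ℝ) :
    fderiv ℝ (fderiv ℝ f) x ![v, w] ![v, w] = v ^ 2 * pd 0 (pd 0 f) x
      + 2 * v * w * pd 1 (pd 0 f) x + w ^ 2 * pd 1 (pd 1 f) x := by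
  have hsym : pd 0 (pd 1 f) x = pd 1 (pd 0 f) x := by
    rw [pd_pd_eq hf, pd_pd_eq hf]
    exact second_derivative_symmetric
      (fun y => (hf.differentiable two_ne_zero y).hasFDerivAt)
      (differentiable_fderiv hf x).hasFDerivAt _ _
  have hv : (![v, w] : Fin 2 → ℝ) = v • Pi.single 0 1 + w • Pi.single 1 1 := by
    ext i; fin_cases i <;> simp
  rw [hv]
  simp only [map_add, map_smul, add_apply, smul_apply, smul_eq_mul, ← pd_pd_eq hf, hsym]
  ring

theorem FiniteCkNorm.exists_bounds {f : (Fin 2 → ℝ) → ℝ} (hf : ContDiff ℝ 2 f)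
    (h : FiniteCkNorm 2 Set.univ f) : ∃ M, 0 ≤ M ∧ (∀ x, |f x| ≤ M) ∧ (∀ j x, |pd j f x| ≤ M) ∧
      ∀ i j x, |pd i (pd j f) x| ≤ M := by
  obtain ⟨M, hM⟩ := h
  have hs : ∀ j : Fin 2, ‖(Pi.single j 1 : Fin 2 → ℝ)‖ = 1 := fun j => by
    simp [Pi.norm_single]
  have h0 : ∀ x, |f x| ≤ M := fun x => by
    have := hM 0 (by norm_num) x trivial
    rwa [norm_iteratedFDeriv_zero] at this
  refine ⟨M, (abs_nonneg _).trans (h0 0), h0, fun j x => ?_, fun i j x => ?_⟩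
  · have := hM 1 (by norm_num) x trivial
    rw [norm_iteratedFDeriv_one] at this
    have h := (fderiv ℝ f x).le_opNorm (Pi.single j 1)
    rw [hs, mul_one] at h
    exact h.trans this
  · have := hM 2 le_rfl x trivial
    rw [← norm_iteratedFDeriv_fderiv, norm_iteratedFDeriv_one] at this
    have h := (fderiv ℝ (fderiv ℝ f) x).le_opNorm₂ (Pi.single i 1) (Pi.single j 1)
    rw [hs, hs, mul_one, mul_one] at h
    rw [pd_pd_eq hf]
    exact h.trans this

/-- A penalized bounded continuous function on the plane attains its maximum. -/
theorem exists_max_sub_sq {d : (Fin 2 → ℝ) → ℝ} (hd : Continuous d) {M ε : ℝ}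
    (hM : ∀ x, d x ≤ M) (hε : 0 < ε) :
    ∃ x, ∀ y, d y - ε * (y 0 ^ 2 + y 1 ^ 2) ≤ d x - ε * (x 0 ^ 2 + x 1 ^ 2) := by
  refine Continuous.exists_forall_ge' (by fun_prop) (0 : Fin 2 → ℝ) ?_
  have hR := (tendsto_norm_cocompact_atTop (E := Fin 2 → ℝ)).eventually_ge_atTop
    (1 + (M - d 0) / ε)
  refine hR.mono fun x hx => ?_
  have h0 : 0 ≤ (M - d 0) / ε := div_nonneg (by linarith [hM 0]) hε.le
  have h1 : ‖x‖ ≤ x 0 ^ 2 + x 1 ^ 2 := by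
    have hx1 : 1 ≤ ‖x‖ := by linarith
    obtain ⟨i, hi⟩ : ∃ i, ‖x‖ = |x i| := by
      obtain ⟨i, hi⟩ := Finite.exists_max fun i => ‖x i‖
      exact ⟨i, le_antisymm ((pi_norm_le_iff_of_nonneg (norm_nonneg _)).2 hi)
        (norm_le_pi_norm x i)⟩
    have h2 : ‖x‖ ≤ x i ^ 2 := by
      rw [← sq_abs, ← hi]
      nlinarith
    fin_cases i
    · exact h2.trans (by simp; positivity)
    · exact h2.trans (by simp; positivity)
  have h3 : M - d 0 ≤ ε * (x 0 ^ 2 + x 1 ^ 2) := by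
    rw [← div_le_iff₀' hε]
    linarith
  simp only [Pi.zero_apply]
  linarith [hM x]

/-- Comparison principle on the whole plane for the mean curvature operator. -/
theorem le_of_meanCurvature_comparison {η ζ : (Fin 2 → ℝ) → ℝ} (hη : ContDiff ℝ 2 η)
    (hζ : ContDiff ℝ 2 ζ) (hηb : FiniteCkNorm 2 Set.univ η) (hζb : FiniteCkNorm 2 Set.univ ζ)
    {c : ℝ} (hc : 0 < c)
    (h : ∀ x, η x < ζ x → c * (ζ x - η x) ≤ meanCurvature ζ x - meanCurvature η x)
    (x₀ : Fin 2 → ℝ) : ζ x₀ ≤ η x₀ := by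
  by_contra! hlt
  obtain ⟨M₁, hM₁, b0, b1, b2⟩ := hηb.exists_bounds hη
  obtain ⟨M₂, hM₂, z0, z1, -⟩ := hζb.exists_bounds hζ
  set M := M₁ + M₂ with hM
  set m := ζ x₀ - η x₀ with hm
  have hmpos : 0 < m := sub_pos.2 hlt
  -- The lower bound `c m / 2` for the curvature difference at the penalized maximum has to beat two
  -- errors of size `c m / 8`, one from the gradients and one from the Hessians.
  obtain ⟨θ, hθ, hunif⟩ := curvatureForm_uniform M (c * m / 8) (by positivity)
  set N := x₀ 0 ^ 2 + x₀ 1 ^ 2 with hN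
  have hN0 : 0 ≤ N := by positivity
  -- The three conditions keep the penalized maximum at least `m / 2`, the gradients there within
  -- `θ`, and the Hessian error at most `c m / 8`.
  obtain ⟨ε, hε, e1, e2, e3⟩ : ∃ ε > 0, ε * N ≤ m / 2 ∧ 4 * ε * (2 * M) < θ ^ 2 ∧
      4 * ε ≤ c * m / 8 := by
    have t1 : Tendsto (fun ε : ℝ => ε * N) (𝓝[>] 0) (𝓝 0) := by
      have : Continuous fun ε : ℝ => ε * N := by fun_prop
      simpa using (this.tendsto 0).mono_left nhdsWithin_le_nhds
    have t2 : Tendsto (fun ε : ℝ => 4 * ε * (2 * M)) (𝓝[>] 0) (𝓝 0) := by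
      have : Continuous fun ε : ℝ => 4 * ε * (2 * M) := by fun_prop
      simpa using (this.tendsto 0).mono_left nhdsWithin_le_nhds
    have t3 : Tendsto (fun ε : ℝ => 4 * ε) (𝓝[>] 0) (𝓝 0) := by
      have : Continuous fun ε : ℝ => 4 * ε := by fun_prop
      simpa using (this.tendsto 0).mono_left nhdsWithin_le_nhds
    obtain ⟨ε, h1, h2, h3, h4⟩ := ((t1.eventually_le_const (half_pos hmpos)).and
      ((t2.eventually_lt_const (sq_pos_of_pos hθ)).and
        ((t3.eventually_le_const (by positivity : 0 < c * m / 8)).and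
          self_mem_nhdsWithin))).exists
    exact ⟨ε, h4, h1, h2, h3⟩
  have hdM : ∀ x, ζ x - η x ≤ M := fun x => by
    linarith [(abs_le.1 (b0 x)).1, (abs_le.1 (z0 x)).2]
  obtain ⟨X, hX⟩ := exists_max_sub_sq (d := fun x => ζ x - η x)
    (hζ.continuous.sub hη.continuous) hdM hε
  have hXm : m / 2 ≤ ζ X - η X - ε * (X 0 ^ 2 + X 1 ^ 2) := by
    have := hX x₀
    linarith
  have hnn : 0 ≤ ε * (X 0 ^ 2 + X 1 ^ 2) := by positivity
  have hline : ∀ v w : ℝ, fderiv ℝ ζ X ![v, w] - fderiv ℝ η X ![v, w]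
        - ε * (2 * X 0 * v + 2 * X 1 * w) = 0 ∧
      fderiv ℝ (fderiv ℝ ζ) X ![v, w] ![v, w] - fderiv ℝ (fderiv ℝ η) X ![v, w] ![v, w]
        - ε * (2 * v ^ 2 + 2 * w ^ 2) ≤ 0 := by
    intro v w
    have hq : ∀ s : ℝ, HasDerivAt (fun s : ℝ => ε * ((X 0 + s * v) ^ 2 + (X 1 + s * w) ^ 2))
        (ε * (2 * (X 0 + s * v) * v + 2 * (X 1 + s * w) * w)) s := by
      intro s
      have l0 : HasDerivAt (fun s : ℝ => X 0 + s * v) v s := by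
        simpa using ((hasDerivAt_id s).mul_const v).const_add (X 0)
      have l1 : HasDerivAt (fun s : ℝ => X 1 + s * w) w s := by
        simpa using ((hasDerivAt_id s).mul_const w).const_add (X 1)
      simpa using ((l0.pow 2).add (l1.pow 2)).const_mul ε
    have hq' : HasDerivAt (fun s : ℝ => ε * (2 * (X 0 + s * v) * v + 2 * (X 1 + s * w) * w))
        (ε * (2 * v ^ 2 + 2 * w ^ 2)) 0 := by
      have l0 : HasDerivAt (fun s : ℝ => X 0 + s * v) v 0 := by
        simpa using ((hasDerivAt_id (0 : ℝ)).mul_const v).const_add (X 0)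
      have l1 : HasDerivAt (fun s : ℝ => X 1 + s * w) w 0 := by
        simpa using ((hasDerivAt_id (0 : ℝ)).mul_const w).const_add (X 1)
      have := ((((l0.const_mul 2).mul_const v).add ((l1.const_mul 2).mul_const w))).const_mul ε
      exact this.congr_deriv (by ring)
    have := deriv_eq_zero_and_second_deriv_nonpos_of_max
      (fun s => ((hasDerivAt_line hζ X ![v, w] s).sub (hasDerivAt_line hη X ![v, w] s)).sub (hq s))
      (((hasDerivAt_fderiv_line hζ X ![v, w]).sub (hasDerivAt_fderiv_line hη X ![v, w])).sub hq')
      (fun s => by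
        refine (hX (X + s • ![v, w])).trans_eq ?_
        simp only [Pi.sub_apply, zero_smul, add_zero, zero_mul])
    simpa only [zero_smul, add_zero, zero_mul] using this
  have hgrad : ∀ j, |pd j ζ X - pd j η X| < θ := by
    have hsq : ∀ j, pd j ζ X - pd j η X = 2 * ε * X j := by
      intro j
      have s0 : (Pi.single 0 1 : Fin 2 → ℝ) = ![1, 0] := by ext i; fin_cases i <;> simp
      have s1 : (Pi.single 1 1 : Fin 2 → ℝ) = ![0, 1] := by ext i; fin_cases i <;> simp
      fin_cases j
      · have := (hline 1 0).1
        rw [← s0] at this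
        change fderiv ℝ ζ X (Pi.single 0 1) - fderiv ℝ η X (Pi.single 0 1) = 2 * ε * X 0
        linarith
      · have := (hline 0 1).1
        rw [← s1] at this
        change fderiv ℝ ζ X (Pi.single 1 1) - fderiv ℝ η X (Pi.single 1 1) = 2 * ε * X 1
        linarith
    intro j
    rw [hsq]
    refine abs_lt_of_sq_lt_sq ?_ hθ.le
    have hj : X j ^ 2 ≤ X 0 ^ 2 + X 1 ^ 2 := by
      fin_cases j
      · simp; positivity
      · simp; positivity
    -- The penalized value at `X` is positive, so the penalty is below the bound for `ζ - η`. This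
    -- controls `ε X²` although `X` may escape to infinity as `ε` tends to zero.
    have hle : ε * X j ^ 2 ≤ 2 * M := by
      have := mul_le_mul_of_nonneg_left hj hε.le
      linarith [hdM X, add_nonneg hM₁ hM₂]
    calc (2 * ε * X j) ^ 2 = 4 * ε * (ε * X j ^ 2) := by ring
      _ ≤ 4 * ε * (2 * M) := by gcongr
      _ < θ ^ 2 := e2
  -- The curvature difference is split in two: here the Hessian changes with the gradient of `ζ`
  -- fixed; in `hfirst` the gradient changes with the Hessian of `η` fixed.
  have hsecond : curvatureForm (pd 0 ζ X) (pd 1 ζ X) (pd 0 (pd 0 ζ) X) (pd 1 (pd 0 ζ) X)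
      (pd 1 (pd 1 ζ) X) - curvatureForm (pd 0 ζ X) (pd 1 ζ X) (pd 0 (pd 0 η) X)
      (pd 1 (pd 0 η) X) (pd 1 (pd 1 η) X) ≤ 2 * (2 * ε) := by
    refine curvatureForm_sub_le (by positivity) fun v w => ?_
    have := (hline v w).2
    rw [hessian_apply_self hζ, hessian_apply_self hη] at this
    linarith
  have hfirst := hunif (pd 0 ζ X) (pd 1 ζ X) (pd 0 η X) (pd 1 η X) (pd 0 (pd 0 η) X)
    (pd 1 (pd 0 η) X) (pd 1 (pd 1 η) X) (by linarith [z1 0 X]) (by linarith [z1 1 X])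
    (by linarith [b1 0 X]) (by linarith [b1 1 X]) (by linarith [b2 0 0 X])
    (by linarith [b2 1 0 X]) (by linarith [b2 1 1 X]) (hgrad 0) (hgrad 1)
  have hcmp := h X (by linarith)
  rw [meanCurvature_eq, meanCurvature_eq] at hcmp
  have hcm : c * (m / 2) ≤ c * (ζ X - η X) := mul_le_mul_of_nonneg_left (by linarith) hc.le
  have := (abs_lt.1 hfirst).2
  have hcpos : 0 < c * m := by positivity
  linarith

/-! ### Translates of the interface and the pressure jump -/

theorem pd_comp_add {n : ℕ} (j : Fin n) (f : (Fin n → ℝ) → ℝ) (τ : Fin n → ℝ) :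
    pd j (fun x => f (x + τ)) = fun x => pd j f (x + τ) := by
  ext x
  simp only [pd, fderiv_comp_add_right]

theorem meanCurvature_comp_add (η : (Fin 2 → ℝ) → ℝ) (τ x : Fin 2 → ℝ) :
    meanCurvature (fun x => η (x + τ)) x = meanCurvature η (x + τ) := by
  simp only [meanCurvature, pd_comp_add]

theorem FiniteCkNorm.comp_add {n k : ℕ} {f : (Fin n → ℝ) → ℝ}
    (h : FiniteCkNorm k Set.univ f) (τ : Fin n → ℝ) :
    FiniteCkNorm k Set.univ fun x => f (x + τ) := by
  obtain ⟨M, hM⟩ := h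
  refine ⟨M, fun m hm x _ => ?_⟩
  rw [iteratedFDeriv_comp_add_right]
  exact hM m hm _ trivial

theorem interfacePoint_add (η : (Fin 2 → ℝ) → ℝ) (x : Fin 2 → ℝ) (a b s : ℝ) :
    interfacePoint η (x + s • ![a, b])
      = ![x 0, x 1, η (x + s • ![a, b])] + s • ![a, b, 0] := by
  ext i
  fin_cases i <;> simp [interfacePoint]

/-- If the interface rises along the axis, the pressure jump across it grows at least
proportionally. -/
theorem pressure_jump_growth {ρ₁ ρ₂ g γ₁ γ₂ a b c₁ c₂ d₁ d₂ M₁ M₂ δ : ℝ}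
    {lo hi η : (Fin 2 → ℝ) → ℝ} {u₁ u₂ : (Fin 3 → ℝ) → (Fin 3 → ℝ)} {P₁ P₂ : (Fin 3 → ℝ) → ℝ}
    (H₁ : IsHorizontalVorticityFlow ρ₁ g γ₁ a b c₁ c₂ M₁ lo η u₁ P₁)
    (H₂ : IsHorizontalVorticityFlow ρ₂ g γ₂ a b d₁ d₂ M₂ η hi u₂ P₂)
    (hsign : ∀ x : Fin 2 → ℝ, pdWithin (closure (layer lo η)) 2 P₁ (interfacePoint η x)
      - pdWithin (closure (layer η hi)) 2 P₂ (interfacePoint η x) ≤ -δ)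
    (x : Fin 2 → ℝ) (t : ℝ) (hlt : η x < η (x + t • ![a, b])) :
    δ * (η (x + t • ![a, b]) - η x) ≤
      (P₂ (interfacePoint η (x + t • ![a, b])) - P₁ (interfacePoint η (x + t • ![a, b])))
        - (P₂ (interfacePoint η x) - P₁ (interfacePoint η x)) := by
  -- For heights between `η x` and `η (x + t e)`, the vertical over `x` lies in the upper fluid and
  -- the vertical over `x + t e` in the lower. The function `P₂ (C 0 z) - P₁ (C t z)` interpolates
  -- between the two pressure jumps.
  let C : ℝ → ℝ → Fin 3 → ℝ := fun s z => ![x 0, x 1, z] + s • ![a, b, 0]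
  have hC2 : ∀ s z, C s z 2 = z := fun s z => by simp [C]
  have hCh : ∀ s z, (![C s z 0, C s z 1] : Fin 2 → ℝ) = x + s • ![a, b] := fun s z => by
    ext i; fin_cases i <;> simp [C]
  have hCC : ∀ s s' z, C s z = C s' z + (s - s') • ![a, b, 0] := fun s s' z => by
    simp only [C]; module
  have hI : ∀ s, interfacePoint η (x + s • ![a, b]) = C s (η (x + s • ![a, b])) :=
    fun s => interfacePoint_add η x a b s
  have hI0 : interfacePoint η x = C 0 (η x) := by
    have := hI 0
    rwa [zero_smul, add_zero] at this
  set z₁ := η x with hz₁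
  set z₂ := η (x + t • ![a, b]) with hz₂
  have hlow : ∀ y, lo y ≤ c₁ := H₁.lo_le
  have hη₁ : ∀ y, c₁ < η y := fun y => H₁.slab.trans_le (H₁.le_hi y)
  have hη₂ : ∀ y, η y < d₂ := fun y => (H₂.lo_le y).trans_lt H₂.slab
  have hmem₁ : ∀ s z, c₁ ≤ z → z ≤ η (x + s • ![a, b]) → C s z ∈ closure (layer lo η) := by
    intro s z h1 h2
    rw [H₁.mem_closure_iff, hC2, hCh]
    exact ⟨(hlow _).trans h1, h2⟩
  have hmem₂ : ∀ s z, z ≤ d₂ → η (x + s • ![a, b]) ≤ z → C s z ∈ closure (layer η hi) := by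
    intro s z h1 h2
    rw [H₂.mem_closure_iff, hC2, hCh]
    exact ⟨h2, h1.trans (H₂.le_hi _)⟩
  have hx0 : x + (0 : ℝ) • ![a, b] = x := by rw [zero_smul, add_zero]
  have hin₁ : ∀ z ∈ Set.Ioo z₁ z₂, C t z ∈ layer lo η := by
    intro z hz
    refine ⟨?_, ?_⟩
    · rw [hC2]; exact (hlow _).trans_lt ((hη₁ x).trans hz.1)
    · rw [hC2, hCh]; exact hz.2
  have hin₂ : ∀ z ∈ Set.Ioo z₁ z₂, C 0 z ∈ layer η hi := by
    intro z hz
    refine ⟨?_, ?_⟩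
    · rw [hC2, hCh, hx0]; exact hz.1
    · rw [hC2]; exact hz.2.trans ((hη₂ _).trans_le (H₂.le_hi _))
  have hCd : ∀ s z, HasDerivAt (C s) (Pi.single 2 1) z := by
    intro s z
    refine hasDerivAt_pi.2 fun i => ?_
    fin_cases i
    · simpa [C] using hasDerivAt_const z (x 0 + s * a)
    · simpa [C] using hasDerivAt_const z (x 1 + s * b)
    · simpa [C] using hasDerivAt_id' z
  have hCc : ∀ s, Continuous (C s) := fun s =>
    continuous_iff_continuousAt.2 fun z => (hCd s z).continuousAt
  have hcont : ContinuousOn (fun z => P₂ (C 0 z) - P₁ (C t z)) (Set.Icc z₁ z₂) := by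
    refine ContinuousOn.sub ?_ ?_
    · exact H₂.euler.contDiffOn_pressure.continuousOn.comp (hCc 0).continuousOn fun z hz =>
        hmem₂ 0 z (hz.2.trans (hη₂ _).le) (by rw [hx0]; exact hz.1)
    · exact H₁.euler.contDiffOn_pressure.continuousOn.comp (hCc t).continuousOn fun z hz =>
        hmem₁ t z ((hη₁ x).le.trans hz.1) hz.2
  obtain ⟨z, hz, hslope⟩ := exists_hasDerivAt_eq_slope (fun z => P₂ (C 0 z) - P₁ (C t z))
    (fun z => pd 2 P₂ (C 0 z) - pd 2 P₁ (C t z)) hlt hcont fun z hz =>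
      (HasFDerivAt.comp_hasDerivAt (l := P₂) z
        (H₂.euler.differentiableAt_pressure H₂.isOpen (hin₂ z hz)).hasFDerivAt (hCd 0 z)).sub
      (HasFDerivAt.comp_hasDerivAt (l := P₁) z
        (H₁.euler.differentiableAt_pressure H₁.isOpen (hin₁ z hz)).hasFDerivAt (hCd t z))
  -- By the intermediate value theorem the interface crosses height `z` somewhere on the line
  -- through `x` in direction `e`. The sign condition there transfers to the two aligned interior
  -- points.
  obtain ⟨s, hs⟩ : ∃ s : ℝ, η (x + s • ![a, b]) = z := by
    have hc : Continuous fun s : ℝ => η (x + s • ![a, b]) :=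
      H₁.continuous_hi.comp (by fun_prop)
    refine mem_range_of_exists_le_of_exists_ge hc ⟨0, ?_⟩ ⟨t, hz.2.le⟩
    rw [hx0]
    exact hz.1.le
  have hs₁ : C s z ∈ closure (layer lo η) := hmem₁ s z ((hη₁ x).trans hz.1).le hs.ge
  have hs₂ : C s z ∈ closure (layer η hi) := hmem₂ s z (hz.2.trans (hη₂ _)).le hs.le
  have e₁ := H₁.pdWithin_pressure_eq (t := t - s) hs₁ (by rw [← hCC]; exact hin₁ z hz)
  have e₂ := H₂.pdWithin_pressure_eq (t := 0 - s) hs₂ (by rw [← hCC]; exact hin₂ z hz)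
  rw [← hCC] at e₁ e₂
  have hsg := hsign (x + s • ![a, b])
  rw [hI, hs, e₁, e₂] at hsg
  -- Invariance along the axis turns the end values of the interpolating function into the jumps
  -- over `x + t e` and over `x`.
  have hP₂ : P₂ (C t z₂) = P₂ (C 0 z₂) := by
    have hm := hmem₂ t z₂ (hη₂ _).le le_rfl
    rw [hCC t 0] at hm ⊢
    exact (H₂.isTwoDimensionalFlow.1 _
      (hmem₂ 0 z₂ (hη₂ _).le (by rw [hx0]; exact hlt.le)) _ hm).2
  have hP₁ : P₁ (C t z₁) = P₁ (C 0 z₁) := by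
    have hm := hmem₁ t z₁ (hη₁ _).le hlt.le
    rw [hCC t 0] at hm ⊢
    exact (H₁.isTwoDimensionalFlow.1 _
      (hmem₁ 0 z₁ (hη₁ _).le (by rw [hx0])) _ hm).2
  rw [eq_div_iff (sub_pos.2 hlt).ne'] at hslope
  have hfin := mul_le_mul_of_nonneg_right
    (show δ ≤ pd 2 P₂ (C 0 z) - pd 2 P₁ (C t z) by linarith) (sub_pos.2 hlt).le
  rw [hslope] at hfin
  rw [hI, hI0, ← hz₂, hP₂]
  linarith

theorem FiniteCkNorm.exists_bound {n k : ℕ} {F : Type*} [NormedAddCommGroup F] [NormedSpace ℝ F]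
    {S : Set (Fin n → ℝ)} {f : (Fin n → ℝ) → F} (h : FiniteCkNorm k S f) :
    ∃ M, ∀ p ∈ S, ‖f p‖ ≤ M := by
  obtain ⟨M, hM⟩ := h
  refine ⟨M, fun p hp => ?_⟩
  have := hM 0 (Nat.zero_le k) p hp
  rwa [norm_iteratedFDeriv_zero] at this

/-! ### Proof of the theorem -/

theorem theorem3 (ρ₁ ρ₂ g σ h₁ h₂ : ℝ) (hρ₁ : 0 < ρ₁) (hρ₂ : 0 < ρ₂) (hσ : 0 < σ)
    (hh₁ : 0 < h₁) (hh₂ : 0 < h₂)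
    (η : (Fin 2 → ℝ) → ℝ) (u₁ u₂ : (Fin 3 → ℝ) → (Fin 3 → ℝ)) (P₁ P₂ : (Fin 3 → ℝ) → ℝ)
    (hwave : IsCapillaryGravityWave ρ₁ ρ₂ g σ h₁ h₂ η u₁ u₂ P₁ P₂)
    -- the vorticities are constant, nonzero and parallel
    (ω₁ ω₂ : Fin 3 → ℝ)
    (hω₁ : ∀ p ∈ lowerLayer h₁ η, curl u₁ p = ω₁) (hω₂ : ∀ p ∈ upperLayer h₂ η, curl u₂ p = ω₂)
    (hω₁0 : ω₁ ≠ 0) (hω₂0 : ω₂ ≠ 0) (hpar : ∃ c : ℝ, ω₁ = c • ω₂)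
    -- finite norms
    (hu₁ : FiniteCkNorm 1 (lowerLayer h₁ η) u₁) (hu₂ : FiniteCkNorm 1 (upperLayer h₂ η) u₂)
    (hη : FiniteCkNorm 2 Set.univ η)
    -- the supremum of `∂P₁/∂z - ∂P₂/∂z` over the interface is negative
    (hsign : ∃ δ : ℝ, 0 < δ ∧ ∀ x : Fin 2 → ℝ,
      pdWithin (closure (lowerLayer h₁ η)) 2 P₁ (interfacePoint η x)
        - pdWithin (closure (upperLayer h₂ η)) 2 P₂ (interfacePoint η x) ≤ -δ) :
    -- the wave is two dimensional: nothing varies along a horizontal direction `(a, b, 0)`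
    ∃ a b : ℝ, a ^ 2 + b ^ 2 = 1 ∧
      (∃ c₁ : ℝ, ω₁ = c₁ • ![a, b, 0]) ∧ (∃ c₂ : ℝ, ω₂ = c₂ • ![a, b, 0]) ∧
      (∀ (x : Fin 2 → ℝ) (t : ℝ), η (x + t • ![a, b]) = η x) ∧
      IsTwoDimensionalFlow ![a, b, 0] (closure (lowerLayer h₁ η)) u₁ P₁ ∧
      IsTwoDimensionalFlow ![a, b, 0] (closure (upperLayer h₂ η)) u₂ P₂ := by
  obtain ⟨δ₁, hδ₁, hbed⟩ := hwave.above_bed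
  obtain ⟨δ₂, hδ₂, hlid⟩ := hwave.below_lid
  obtain ⟨δ, hδ, hsign⟩ := hsign
  obtain ⟨c, hc⟩ := hpar
  obtain ⟨M₁, hM₁⟩ := hu₁.exists_bound
  obtain ⟨M₂, hM₂⟩ := hu₂.exists_bound
  have hηc := hwave.contDiff_interface
  have hc0 : c ≠ 0 := by
    rintro rfl
    exact hω₁0 (by rw [hc, zero_smul])
  -- The plane midway in the gap below the lid lies entirely in the upper fluid. Parallelism settles
  -- the lower vorticity.
  have hvert : ω₂ 2 = 0 := by
    have hin : ∀ x y : ℝ, (![x, y, h₂ - δ₂ / 2] : Fin 3 → ℝ) ∈ upperLayer h₂ η := fun x y =>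
      ⟨show η ![x, y] < h₂ - δ₂ / 2 by linarith [hlid ![x, y]],
        show h₂ - δ₂ / 2 < h₂ by linarith⟩
    have hopen : IsOpen (upperLayer h₂ η) := isOpen_layer hηc.continuous continuous_const
    exact vertical_vorticity_eq_zero
      (fun x y => hwave.euler_upper.differentiableAt_velocity hopen (hin x y))
      (fun x y => congrFun (hω₂ _ (hin x y)) 2) (fun x y => hM₂ _ (hin x y))
  set r := √(ω₂ 0 ^ 2 + ω₂ 1 ^ 2) with hr
  have hr2 : r ^ 2 = ω₂ 0 ^ 2 + ω₂ 1 ^ 2 := Real.sq_sqrt (by positivity)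
  have hr0 : r ≠ 0 := by
    intro h0
    rw [h0] at hr2
    apply hω₂0
    ext i
    fin_cases i
    · change ω₂ 0 = 0
      nlinarith [sq_nonneg (ω₂ 0), sq_nonneg (ω₂ 1)]
    · change ω₂ 1 = 0
      nlinarith [sq_nonneg (ω₂ 0), sq_nonneg (ω₂ 1)]
    · exact hvert
  set a := ω₂ 0 / r with ha
  set b := ω₂ 1 / r with hb
  have hab : a ^ 2 + b ^ 2 = 1 := by
    rw [ha, hb, div_pow, div_pow, ← add_div, ← hr2, div_self (pow_ne_zero 2 hr0)]
  have hω₂e : ω₂ = r • ![a, b, 0] := by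
    ext i
    fin_cases i
    · simp [ha, mul_div_cancel₀ _ hr0]
    · simp [hb, mul_div_cancel₀ _ hr0]
    · simpa using hvert
  have hω₁e : ω₁ = (c * r) • ![a, b, 0] := by rw [hc, hω₂e, smul_smul]
  have H₁ : IsHorizontalVorticityFlow ρ₁ g (c * r) a b (-h₁) (-h₁ + δ₁) M₁ (fun _ => -h₁) η
      u₁ P₁ :=
    { density_ne_zero := hρ₁.ne'
      vorticity_ne_zero := mul_ne_zero hc0 hr0
      unit := hab
      continuous_lo := continuous_const
      continuous_hi := hηc.continuous
      slab := by linarith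
      lo_le := fun _ => le_rfl
      le_hi := hbed
      euler := hwave.euler_lower
      curl_eq := fun p hp => (hω₁ p hp).trans hω₁e
      bound := hM₁ }
  have H₂ : IsHorizontalVorticityFlow ρ₂ g r a b (h₂ - δ₂) h₂ M₂ η (fun _ => h₂) u₂ P₂ :=
    { density_ne_zero := hρ₂.ne'
      vorticity_ne_zero := hr0
      unit := hab
      continuous_lo := hηc.continuous
      continuous_hi := continuous_const
      slab := by linarith
      lo_le := hlid
      le_hi := fun _ => le_rfl
      euler := hwave.euler_upper
      curl_eq := fun p hp => (hω₂ p hp).trans hω₂e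
      bound := hM₂ }
  -- Young-Laplace turns growth of the pressure jump at rate `δ` into growth of the curvature at
  -- rate `δ / σ`.
  have hle : ∀ (t : ℝ) (x : Fin 2 → ℝ), η (x + t • ![a, b]) ≤ η x := by
    intro t
    refine le_of_meanCurvature_comparison (ζ := fun x => η (x + t • ![a, b])) hηc
      (hηc.comp (contDiff_id.add contDiff_const)) hη (hη.comp_add _) (div_pos hδ hσ) ?_
    intro x hx
    have h := pressure_jump_growth H₁ H₂ hsign x t hx
    rw [hwave.young_laplace, hwave.young_laplace, ← mul_sub] at h
    rw [meanCurvature_comp_add, div_mul_eq_mul_div, div_le_iff₀' hσ]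
    exact h
  refine ⟨a, b, hab, ⟨c * r, hω₁e⟩, ⟨r, hω₂e⟩, fun x t => le_antisymm (hle t x) ?_,
    H₁.isTwoDimensionalFlow, H₂.isTwoDimensionalFlow⟩
  -- The reverse inequality is the same bound for the opposite translation, based at the translated
  -- point.
  have := hle (-t) (x + t • ![a, b])
  rwa [add_assoc, ← add_smul, add_neg_cancel, zero_smul, add_zero] at this
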